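/- Write $\mathbb S^3=\{(z_1,z_2)\in\mathbb C^2:|z_1|^2+|z_2|^2=1\}$, and let $h:\mathbb S^3\to\mathbb S^2$ be the Hopf map, i.e. $(z_1,z_2)\mapsto[z_1:z_2]\in\mathbb{CP}^1$ followed by inverse stereographic projection $[1:w]\mapsto(1+|w|^2)^{-1}(2\,\mathrm{Re}\,w,\,2\,\mathrm{Im}\,w,\,|w|^2-1)$; its fibres are the circles $\{e^{i\theta}z:\theta\in[0,2\pi)\}$. The Spherical ensemble of $r$ points is the random $r$-tuple in $\mathbb S^2$ whose joint density with respect to the product of the surface measures is proportional to $\prod_{i<j}\|x_i-x_j\|^2$. For positive integers $k,r$ and $N=kr$, let $\omega_N=\{p_1,\dots,p_N\}\subset\mathbb S^3$ be the random set obtained by drawing $r$ points from the Spherical ensemble and placing on the Hopf fibre over each of them $k$ equally spaced points, the points on each fibre being rotated by an angle uniform in $[0,2\pi)$, where the $r$ angles are independent of each other and of the Spherical ensemble. Let $E_0(\omega_N)=\sum_{i\ne j}\log\frac1{\|p_i-p_j\|}$ be the logarithmic energy. **Theorem.** The energy $E_0(\omega_N)$ is integrable. Let $A,B,k,r$ be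 positive integers with $r=\frac AB k^2$, and let $N=kr$. Then $$\mathbb E[E_0(\omega_N)]=-\frac{N^2}{4}-\frac13N\log N+N\left(\frac{\sqrt\pi}{4}\Big(\frac BA\Big)^{1/2}-\log\Big(\Big(\frac BA\Big)^{1/3}\Big)\right)+o(N)\qquad(k\to\infty).$$ This holds in particular for fixed $A/B$ (a rational approximation of $9\pi/64$). Here $A/B$ may also vary with $k$, the $o(N)$ being uniform over $A/B\ge\delta$ for every fixed $\delta>0$. Moreover, the coefficient of the linear term tends to $\frac13\left(2+\log\frac{9\pi}{64}\right)=0.394\ldots$ as $\frac AB\to\frac{9\pi}{64}$. -/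

import Mathlib

open MeasureTheory Filter Topology

/-- The unit sphere `S²` in Euclidean space `ℝ³`. -/
abbrev Sphere2 : Type := Metric.sphere (0 : EuclideanSpace ℝ (Fin 3)) 1

/-- The unit sphere `S³`, viewed as the unit sphere in `ℂ²` with the Euclidean norm
`‖(z₁, z₂)‖² = |z₁|² + |z₂|²`. -/
abbrev Sphere3 : Type := Metric.sphere (0 : EuclideanSpace ℂ (Fin 2)) 1

theorem sphere2_sq (y : Sphere2) : y.1 0 ^ 2 + y.1 1 ^ 2 + y.1 2 ^ 2 = 1 := by
  have h : ‖y.1‖ = 1 := by simp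
  rw [EuclideanSpace.norm_eq, Real.sqrt_eq_one] at h
  simpa [Fin.sum_univ_three] using h

theorem sphere3_normSq (z : Sphere3) :
    Complex.normSq (z.1 0) + Complex.normSq (z.1 1) = 1 := by
  have h : ‖z.1‖ = 1 := by simp
  rw [EuclideanSpace.norm_eq, Real.sqrt_eq_one] at h
  simpa [Fin.sum_univ_two, Complex.normSq_eq_norm_sq] using h

theorem mem_sphere3_iff (z : EuclideanSpace ℂ (Fin 2)) :
    z ∈ Metric.sphere (0 : EuclideanSpace ℂ (Fin 2)) 1 ↔
      Complex.normSq (z 0) + Complex.normSq (z 1) = 1 := by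
  rw [mem_sphere_zero_iff_norm, EuclideanSpace.norm_eq, Real.sqrt_eq_one]
  simp [Fin.sum_univ_two, Complex.normSq_eq_norm_sq]

/-- The Hopf map `S³ → S²`: the quotient map `(z₁, z₂) ↦ [z₁ : z₂]` to `ℂP¹` followed by
inverse stereographic projection
`[1 : w] ↦ (2 Re w, 2 Im w, |w|² - 1) / (1 + |w|²)`. -/
noncomputable def hopfMap (z : Sphere3) : Sphere2 :=
  ⟨!₂[2 * ((starRingEnd ℂ) (z.1 0) * z.1 1).re,
      2 * ((starRingEnd ℂ) (z.1 0) * z.1 1).im,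
      Complex.normSq (z.1 1) - Complex.normSq (z.1 0)], by
    have h := sphere3_normSq z
    simp only [Complex.normSq_apply] at h
    rw [mem_sphere_zero_iff_norm, EuclideanSpace.norm_eq, Real.sqrt_eq_one]
    simp [Fin.sum_univ_three, Complex.normSq_apply]
    linear_combination (((z.1 0).re * (z.1 0).re + (z.1 0).im * (z.1 0).im +
      ((z.1 1).re * (z.1 1).re + (z.1 1).im * (z.1 1).im)) + 1) * h⟩

/-- The action `e^{iθ} · (z₁, z₂) = (e^{iθ} z₁, e^{iθ} z₂)` on `S³`, whose orbits are the
Hopf fibres. -/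
noncomputable def fibreRotation (θ : ℝ) (z : Sphere3) : Sphere3 :=
  ⟨Complex.exp (θ * Complex.I) • z.1, by
    have h : ‖z.1‖ = 1 := by simp
    rw [mem_sphere_zero_iff_norm, norm_smul, Complex.norm_exp_ofReal_mul_I, h, one_mul]⟩

/-- A base point on the Hopf fibre over `y ∈ S²`. -/
noncomputable def fibreBasePoint (y : Sphere2) : Sphere3 :=
  ⟨if y.1 2 = 1 then !₂[0, 1] else
    !₂[(Real.sqrt ((1 - y.1 2) / 2) : ℂ),
       (⟨y.1 0, y.1 1⟩ : ℂ) / (2 * Real.sqrt ((1 - y.1 2) / 2) : ℝ)], by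
    have h := sphere2_sq y
    rw [mem_sphere3_iff]
    split_ifs with h1
    · simp
    · have h2 : y.1 2 < 1 := lt_of_le_of_ne (by nlinarith [sq_nonneg (y.1 0), sq_nonneg (y.1 1)]) h1
      have h3 : 0 ≤ (1 - y.1 2) / 2 := by linarith
      have h4 : (1 - y.1 2) ≠ 0 := by linarith
      have h5 := Real.mul_self_sqrt h3
      simp only [Matrix.cons_val_zero, Matrix.cons_val_one, map_div₀,
        Complex.normSq_ofReal, Complex.normSq_mk]
      rw [mul_mul_mul_comm, h5]
      field_simp
      linear_combination h⟩

/-- The base point does lie on the fibre `h⁻¹(y)`. -/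
theorem hopfMap_fibreBasePoint (y : Sphere2) : hopfMap (fibreBasePoint y) = y := by
  have h := sphere2_sq y
  apply Subtype.ext
  ext i
  by_cases h1 : y.1 2 = 1
  · have h6 : y.1 0 = 0 := by nlinarith [sq_nonneg (y.1 0), sq_nonneg (y.1 1)]
    have h7 : y.1 1 = 0 := by nlinarith [sq_nonneg (y.1 0), sq_nonneg (y.1 1)]
    fin_cases i <;> simp [hopfMap, fibreBasePoint, h1, h6, h7]
  · have h2 : y.1 2 < 1 := lt_of_le_of_ne (by nlinarith [sq_nonneg (y.1 0), sq_nonneg (y.1 1)]) h1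
    have h3 : 0 < (1 - y.1 2) / 2 := by linarith
    have h4 : (1 - y.1 2) ≠ 0 := by linarith
    have h5 := Real.mul_self_sqrt h3.le
    have h6 : Real.sqrt ((1 - y.1 2) / 2) ≠ 0 := (Real.sqrt_pos.2 h3).ne'
    fin_cases i
    · simp only [Fin.zero_eta, Fin.mk_one, hopfMap, fibreBasePoint, h1, if_false,
        Matrix.cons_val_zero, Matrix.cons_val_one, Complex.conj_ofReal, Complex.re_ofReal_mul,
        Complex.im_ofReal_mul, Complex.div_ofReal_re]
      field_simp
    · simp only [Fin.zero_eta, Fin.mk_one, hopfMap, fibreBasePoint, h1, if_false,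
        Matrix.cons_val_zero, Matrix.cons_val_one, Complex.conj_ofReal, Complex.re_ofReal_mul,
        Complex.im_ofReal_mul, Complex.div_ofReal_im]
      field_simp
    · simp only [hopfMap, fibreBasePoint, h1, if_false, Matrix.cons_val_zero,
        Matrix.cons_val_one, map_div₀, Complex.normSq_ofReal, Complex.normSq_mk]
      rw [mul_mul_mul_comm, h5]
      simp
      field_simp
      linear_combination h

/-- Rotating along the fibre does not leave the fibre. -/
theorem hopfMap_fibreRotation (θ : ℝ) (z : Sphere3) :
    hopfMap (fibreRotation θ z) = hopfMap z := by
  have hn : Complex.normSq (Complex.exp (θ * Complex.I)) = 1 := by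
    rw [Complex.normSq_eq_norm_sq, Complex.norm_exp_ofReal_mul_I, one_pow]
  have hc : (starRingEnd ℂ) (Complex.exp (θ * Complex.I) * z.1 0) *
      (Complex.exp (θ * Complex.I) * z.1 1) = (starRingEnd ℂ) (z.1 0) * z.1 1 := by
    have h1 : (starRingEnd ℂ) (Complex.exp (θ * Complex.I)) * Complex.exp (θ * Complex.I) = 1 := by
      rw [← Complex.normSq_eq_conj_mul_self, hn, Complex.ofReal_one]
    rw [map_mul]
    linear_combination ((starRingEnd ℂ) (z.1 0) * z.1 1) * h1
  apply Subtype.ext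
  simp only [hopfMap, fibreRotation, PiLp.smul_apply, smul_eq_mul, hc,
    Complex.normSq_mul, hn, one_mul]

/-- Surface area measure on `S²` (of total mass `4π`). -/
noncomputable def surfaceMeasure : Measure Sphere2 :=
  (volume : Measure (EuclideanSpace ℝ (Fin 3))).toSphere

/-- The unnormalized law of the Spherical ensemble: density `∏_{i<j} ‖xᵢ - xⱼ‖²` with respect
to the product of the surface measures. -/
noncomputable def sphericalWeight (r : ℕ) : Measure (Fin r → Sphere2) :=
  (Measure.pi fun _ : Fin r => surfaceMeasure).withDensity fun x =>
    ENNReal.ofReal (∏ i : Fin r, ∏ j ∈ Finset.Ioi i, dist (x i) (x j) ^ 2)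

/-- The law of the `r` points of the Spherical ensemble on `S²`: the probability measure with
joint density proportional to `∏_{i<j} ‖xᵢ - xⱼ‖²`. -/
noncomputable def sphericalEnsemble (r : ℕ) : Measure (Fin r → Sphere2) :=
  (sphericalWeight r Set.univ)⁻¹ • sphericalWeight r

/-- The uniform probability measure on the angles `[0, 2π)`. -/
noncomputable def uniformAngle : Measure ℝ :=
  (volume (Set.Ico 0 (2 * Real.pi)))⁻¹ • volume.restrict (Set.Ico 0 (2 * Real.pi))

/-- The `k` equally spaced points on each of the fibres over `y₁, …, y_r`, the points on the
`i`-th fibre being rotated by the angle `θᵢ`. -/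
noncomputable def fibredPoints (k r : ℕ) (y : Fin r → Sphere2) (θ : Fin r → ℝ) :
    Fin r × Fin k → Sphere3 :=
  fun p => fibreRotation (θ p.1 + 2 * Real.pi * (p.2 : ℕ) / k) (fibreBasePoint (y p.1))

/-- The discrete logarithmic energy `∑_{i ≠ j} log (1 / ‖xᵢ - xⱼ‖)`. -/
noncomputable def logEnergy {ι X : Type*} [Fintype ι] [DecidableEq ι] [MetricSpace X]
    (x : ι → X) : ℝ :=
  ∑ i, ∑ j ∈ Finset.univ.erase i, Real.log (1 / dist (x i) (x j))

/-- The joint law of the base points (Spherical ensemble) and of the independent uniform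
rotations of the fibres, all rotations being independent of the base points. -/
noncomputable def fibredSphericalLaw (r : ℕ) : Measure ((Fin r → Sphere2) × (Fin r → ℝ)) :=
  (sphericalEnsemble r).prod (Measure.pi fun _ : Fin r => uniformAngle)

/-- The random logarithmic energy of the fibred Spherical ensemble with `k` points on each of
`r` fibres. -/
noncomputable def fibredSphericalEnergy (k r : ℕ)
    (ω : (Fin r → Sphere2) × (Fin r → ℝ)) : ℝ :=
  logEnergy (fibredPoints k r ω.1 ω.2)

/-- The coefficient `(√π / 4) (B/A)^{1/2} - log ((B/A)^{1/3})` of the linear term. -/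
noncomputable def linearCoefficient (A B : ℕ) : ℝ :=
  Real.sqrt Real.pi / 4 * ((B : ℝ) / A) ^ (1 / 2 : ℝ) - Real.log (((B : ℝ) / A) ^ (1 / 3 : ℝ))

/-! The expected energy is computed exactly, and only one scalar integral is then estimated.

Within a fibre there is no randomness: since `∏ (1 - ζ ^ d) = k` over the nontrivial `k`-th roots of
unity, each fibre contributes `-k log k` (`sum_log_dist_fibre`).

For two different fibres over `x, y`, put `D = dist x y / 2`. As a function of the relative rotation
`θ`, the distance of two points is `‖α e^{iθ} - c‖` with `α² = 1 + D` and `‖c‖² = 1 - D`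
(`dist_fibreRotation`). Since `c` lies in the disc of radius `α`, the mean of the logarithm over the
circle is `log α`, so the averaged interaction is `-(1/2) log (1 + D)`
(`integral_log_dist_fibreRotation`). The singularity is gone: what remains is a bounded function of
`dist x y`.

The Spherical ensemble is determinantal. Its density is a multiple of `|det|²` for an orthonormal
family of monomials in the homogeneous coordinates of the base point, whose reproducing kernel is `n
/ (4π)` times a power of the Hermitian product. Hence the two-point function depends only on `t =
dist² / 4` and is proportional to `1 - (1 - t) ^ (n - 1)`, while `t` is uniform on `(0, 1)` by
Archimedes' theorem (`sum_integral_sphericalEnsemble`).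

Together these give `-N²/4 + (N²/2) * correction (r - 1) - N log k`, where `correction n` is the
integral of `log (1 + √t) (1 - t) ^ n` (`integral_fibredSphericalEnergy_eq`). Replacing `log (1 +
√t)` by `√t` turns it into a beta integral, so it is asymptotic to `(√π/2) n^{-3/2}`
(`tendsto_rpow_mul_correction`). With `r = (A/B) k²` the middle term becomes `N (√π/4) (B/A)^{1/2}`
up to `o(N)`, and `-N log k` is exactly `-(1/3) N log N - N log ((B/A)^{1/3})`. -/

/-! ### Surface measure in Archimedes coordinates -/

open Set Real in
theorem lintegral_euclidean_three_cylindrical (H : EuclideanSpace ℝ (Fin 3) → ENNReal)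
    (hH : Measurable H) :
    ∫⁻ y, H y = ∫⁻ φ in Ioo (-π) π, ∫⁻ z : ℝ, ∫⁻ ρ in Ioi (0 : ℝ),
      ENNReal.ofReal ρ * H !₂[ρ * cos φ, ρ * sin φ, z] := by
  have hm : Measurable fun q : ℝ × ℝ × ℝ => H !₂[q.2.1, q.2.2, q.1] := by fun_prop
  have h1 : ∫⁻ y, H y = ∫⁻ q : ℝ × ℝ × ℝ, H !₂[q.2.1, q.2.2, q.1] := by
    have e1 := EuclideanSpace.volume_preserving_symm_measurableEquiv_toLp (Fin 3)
    have e2 := volume_preserving_piFinSuccAbove (fun _ : Fin 3 => ℝ) 2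
    have e3 := (MeasurePreserving.id (volume : Measure ℝ)).prod (volume_preserving_finTwoArrow ℝ)
    refine Eq.trans ?_ (((e3.comp e2).comp e1).lintegral_comp hm)
    refine lintegral_congr fun y => ?_
    congr 1
    ext i
    fin_cases i <;> rfl
  rw [h1, Measure.volume_eq_prod, lintegral_prod _ hm.aemeasurable]
  have h2 : ∀ z : ℝ, ∫⁻ p : ℝ × ℝ, H !₂[p.1, p.2, z] =
      ∫⁻ φ in Ioo (-π) π, ∫⁻ ρ in Ioi (0 : ℝ),
        ENNReal.ofReal ρ * H !₂[ρ * cos φ, ρ * sin φ, z] := by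
    intro z
    rw [← lintegral_comp_polarCoord_symm, polarCoord_target, Measure.volume_eq_prod, setLIntegral_prod_symm]
    · simp [polarCoord_symm_apply]
    · simp only [polarCoord_symm_apply, smul_eq_mul]
      fun_prop
  simp only [h2]
  rw [lintegral_lintegral_swap]
  apply Measurable.aemeasurable
  apply Measurable.lintegral_prod_right'
    (f := fun q : (ℝ × ℝ) × ℝ => ENNReal.ofReal q.2 * H !₂[q.2 * cos q.1.2, q.2 * sin q.1.2, q.1.1])
  fun_prop

open Set Real in
/-- Polar coordinates in the half plane `{(z, ρ) | 0 < ρ}`. -/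
theorem lintegral_halfPlane_polar (H : ℝ → ℝ → ENNReal) (hH : Measurable fun p : ℝ × ℝ => H p.1 p.2) :
    ∫⁻ z : ℝ, ∫⁻ ρ in Ioi (0 : ℝ), H z ρ =
      ∫⁻ α in Ioo 0 π, ∫⁻ R in Ioi (0 : ℝ), ENNReal.ofReal R * H (R * cos α) (R * sin α) := by
  have hS : MeasurableSet {p : ℝ × ℝ | 0 < p.2} := measurableSet_lt measurable_const measurable_snd
  have h1 : ∫⁻ z : ℝ, ∫⁻ ρ in Ioi (0 : ℝ), H z ρ =
      ∫⁻ p : ℝ × ℝ, {p : ℝ × ℝ | 0 < p.2}.indicator (fun p => H p.1 p.2) p := by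
    rw [Measure.volume_eq_prod, lintegral_prod _ (hH.indicator hS).aemeasurable]
    refine lintegral_congr fun z => ?_
    rw [← lintegral_indicator measurableSet_Ioi]
    rfl
  rw [h1, ← lintegral_comp_polarCoord_symm, polarCoord_target, Measure.volume_eq_prod, setLIntegral_prod_symm]
  · rw [← lintegral_indicator measurableSet_Ioo, ← lintegral_indicator measurableSet_Ioo]
    refine lintegral_congr fun α => ?_
    by_cases h0 : α ∈ Ioo 0 π
    · have h0' : α ∈ Ioo (-π) π := ⟨by linarith [h0.1, pi_pos], h0.2⟩
      rw [indicator_of_mem h0, indicator_of_mem h0']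
      refine setLIntegral_congr_fun measurableSet_Ioi fun R hR => ?_
      have : 0 < R * sin α := mul_pos hR (sin_pos_of_mem_Ioo h0)
      simp [polarCoord_symm_apply, this]
    · rw [indicator_of_notMem h0]
      by_cases h0' : α ∈ Ioo (-π) π
      · rw [indicator_of_mem h0']
        rw [setLIntegral_congr_fun (g := fun _ => 0) measurableSet_Ioi, lintegral_zero]
        intro R hR
        have h3 : α ≤ 0 := by
          by_contra h
          exact h0 ⟨not_le.1 h, h0'.2⟩
        have : ¬ 0 < R * sin α :=
          not_lt.2 (mul_nonpos_of_nonneg_of_nonpos (le_of_lt hR)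
            (sin_nonpos_of_nonpos_of_neg_pi_le h3 h0'.1.le))
        simp [polarCoord_symm_apply, this]
      · rw [indicator_of_notMem h0']
  · simp only [polarCoord_symm_apply, smul_eq_mul]
    have := hH.indicator hS
    have h5 : Measurable fun x : ℝ × ℝ => (x.1 * cos x.2, x.1 * sin x.2) := by fun_prop
    exact ((ENNReal.measurable_ofReal.comp measurable_fst).mul (this.comp h5)).aemeasurable

-- A function constant on rays separates from the radius; the factor 3 inverts `∫₀¹ R² dR = 1/3`.
-- This lets Lebesgue coordinates on the ball be used for the sphere.
open Set in
theorem lintegral_surfaceMeasure_eq_ball (F : EuclideanSpace ℝ (Fin 3) → ENNReal)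
    (hF : Measurable F) :
    ∫⁻ x, F x.1 ∂surfaceMeasure =
      3 * ∫⁻ y : EuclideanSpace ℝ (Fin 3),
        (Iio (1 : ℝ)).indicator (fun _ => F (‖y‖⁻¹ • y)) ‖y‖ := by
  have hmp := (volume : Measure (EuclideanSpace ℝ (Fin 3))).measurePreserving_homeomorphUnitSphereProd
  rw [finrank_euclideanSpace_fin] at hmp
  let one : Ioi (0 : ℝ) := ⟨1, mem_Ioi.2 one_pos⟩
  have h1 : ∫⁻ p, F p.1.1 * (Iio one).indicator 1 p.2 ∂(surfaceMeasure.prod (Measure.volumeIoiPow 2))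
      = (∫⁻ x, F x.1 ∂surfaceMeasure) * ENNReal.ofReal (1 / 3) := by
    rw [lintegral_prod_mul (f := fun x : Sphere2 => F x.1) (by fun_prop)
      ((measurable_one.indicator measurableSet_Iio).aemeasurable), lintegral_indicator_one measurableSet_Iio,
      Measure.volumeIoiPow_apply_Iio]
    norm_num [one]
  have hm : Measurable fun p : Sphere2 × Ioi (0 : ℝ) => F p.1.1 * (Iio one).indicator 1 p.2 := by
    have : Measurable ((Iio one).indicator (1 : Ioi (0 : ℝ) → ENNReal)) :=
      measurable_one.indicator measurableSet_Iio
    fun_prop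
  have h2 : ∫⁻ p, F p.1.1 * (Iio one).indicator 1 p.2 ∂(surfaceMeasure.prod (Measure.volumeIoiPow 2))
      = ∫⁻ y : EuclideanSpace ℝ (Fin 3),
        (Iio (1 : ℝ)).indicator (fun _ => F (‖y‖⁻¹ • y)) ‖y‖ := by
    rw [surfaceMeasure, ← hmp.lintegral_comp hm]
    conv_rhs => rw [← restrict_compl_singleton (μ := (volume : Measure (EuclideanSpace ℝ (Fin 3)))) 0,
      ← lintegral_subtype_comap (measurableSet_singleton _).compl]
    refine lintegral_congr fun y => ?_
    by_cases hy : ‖y.1‖ < 1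
    · have : (homeomorphUnitSphereProd (EuclideanSpace ℝ (Fin 3)) y).2 ∈ Iio one := by
        rw [mem_Iio, ← Subtype.coe_lt_coe]; simpa using! hy
      rw [indicator_of_mem this, indicator_of_mem (by exact hy)]
      simp
    · have : (homeomorphUnitSphereProd (EuclideanSpace ℝ (Fin 3)) y).2 ∉ Iio one := by
        rw [mem_Iio, ← Subtype.coe_lt_coe]; simpa using! hy
      rw [indicator_of_notMem this, indicator_of_notMem (by exact hy), mul_zero]
  rw [← h2, h1, mul_comm (∫⁻ x, F x.1 ∂surfaceMeasure), ← mul_assoc]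
  have : (3 : ENNReal) * ENNReal.ofReal (1 / 3) = 1 := by
    rw [← ENNReal.ofReal_ofNat, ← ENNReal.ofReal_mul (by norm_num)]; norm_num
  rw [this, one_mul]

/-- The point of `S²` over `t`, `φ`, where `t = (1 - x₂) / 2` and `φ` is the longitude. -/
noncomputable def spherePoint (p : ℝ × ℝ) : EuclideanSpace ℝ (Fin 3) :=
  !₂[2 * Real.sqrt (p.1 * (1 - p.1)) * Real.cos p.2,
    2 * Real.sqrt (p.1 * (1 - p.1)) * Real.sin p.2, 1 - 2 * p.1]

theorem measurable_spherePoint : Measurable spherePoint := by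
  unfold spherePoint; fun_prop

-- Substitution `t = (1 - cos α) / 2`, with `dt = (sin α / 2) dα`: height on the sphere becomes a
-- uniform variable.
open Set Real in
theorem lintegral_sin_mul_comp_cos (g : ℝ → ENNReal) :
    ∫⁻ α in Ioo 0 π, ENNReal.ofReal (sin α) * g ((1 - cos α) / 2) =
      2 * ∫⁻ t in Ioo (0 : ℝ) 1, g t := by
  have himg : (fun α : ℝ => (1 - cos α) / 2) '' Ioo 0 π = Ioo 0 1 := by
    ext t
    constructor
    · rintro ⟨α, hα, rfl⟩
      have h1 : cos α < cos 0 := strictAntiOn_cos ⟨le_rfl, pi_pos.le⟩ ⟨hα.1.le, hα.2.le⟩ hα.1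
      have h2 : cos π < cos α := strictAntiOn_cos ⟨hα.1.le, hα.2.le⟩ ⟨pi_pos.le, le_rfl⟩ hα.2
      rw [cos_zero] at h1
      rw [cos_pi] at h2
      constructor <;> simp only <;> linarith
    · intro ht
      refine ⟨arccos (1 - 2 * t), ⟨arccos_pos.2 (by linarith [ht.1]), ?_⟩, ?_⟩
      · refine lt_of_le_of_ne (arccos_le_pi _) fun h => ?_
        rw [arccos_eq_pi] at h
        linarith [ht.2]
      · simp only
        rw [cos_arccos (by linarith [ht.2]) (by linarith [ht.1])]
        ring
  rw [← himg, lintegral_image_eq_lintegral_abs_deriv_mul (f' := fun α => sin α / 2)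
    measurableSet_Ioo _ _ g, ← lintegral_const_mul' _ _ (by simp)]
  · refine setLIntegral_congr_fun measurableSet_Ioo fun α hα => ?_
    have h := (sin_pos_of_mem_Ioo hα).le
    rw [abs_of_nonneg (by linarith), ← mul_assoc, ← ENNReal.ofReal_ofNat,
      ← ENNReal.ofReal_mul (by norm_num)]
    congr 2
    ring
  · intro α _
    have := ((hasDerivAt_cos α).const_sub 1).div_const 2
    simpa using! this.hasDerivWithinAt
  · intro a ha b hb hab
    exact injOn_cos ⟨ha.1.le, ha.2.le⟩ ⟨hb.1.le, hb.2.le⟩ (by simp only at hab; linarith)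

open Set Real in
theorem lintegral_surfaceMeasure (F : EuclideanSpace ℝ (Fin 3) → ENNReal) (hF : Measurable F) :
    ∫⁻ x, F x.1 ∂surfaceMeasure =
      2 * ∫⁻ φ in Ioo (-π) π, ∫⁻ t in Ioo (0 : ℝ) 1, F (spherePoint (t, φ)) := by
  rw [lintegral_surfaceMeasure_eq_ball F hF, lintegral_euclidean_three_cylindrical]
  swap
  · have hS : MeasurableSet {y : EuclideanSpace ℝ (Fin 3) | ‖y‖ < 1} :=
      measurableSet_lt measurable_norm measurable_const
    exact (show Measurable fun y : EuclideanSpace ℝ (Fin 3) => F (‖y‖⁻¹ • y) by fun_prop).indicator hS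
  rw [← lintegral_const_mul' _ _ (by simp), ← lintegral_const_mul' _ _ (by simp)]
  refine lintegral_congr fun φ => ?_
  rw [lintegral_halfPlane_polar]
  swap
  · have hS : MeasurableSet {p : ℝ × ℝ | ‖!₂[p.2 * cos φ, p.2 * sin φ, p.1]‖ < 1} :=
      measurableSet_lt (by fun_prop) measurable_const
    exact (show Measurable fun p : ℝ × ℝ => ENNReal.ofReal p.2 by fun_prop).mul
      ((show Measurable fun p : ℝ × ℝ => F (‖!₂[p.2 * cos φ, p.2 * sin φ, p.1]‖⁻¹ •
        !₂[p.2 * cos φ, p.2 * sin φ, p.1]) by fun_prop).indicator hS)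
  rw [← lintegral_sin_mul_comp_cos, ← lintegral_const_mul' _ _ (by simp)]
  refine setLIntegral_congr_fun measurableSet_Ioo fun α hα => ?_
  have hs := sin_pos_of_mem_Ioo hα
  have hsq : 2 * √((1 - cos α) / 2 * (1 - (1 - cos α) / 2)) = sin α := by
    rw [show (1 - cos α) / 2 * (1 - (1 - cos α) / 2) = (sin α / 2) ^ 2 by
      rw [div_pow, sin_sq]; ring, sqrt_sq (by linarith)]
    ring
  -- The polar Jacobian `R` and the cylindrical Jacobian `R sin α` multiply to `R² sin α`, and the
  -- integrand depends on the direction only, so the radial integral splits off.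
  have h1 : ∀ R ∈ Ioi (0 : ℝ), ENNReal.ofReal R * (ENNReal.ofReal (R * sin α) *
      (Iio (1 : ℝ)).indicator (fun _ => F (‖!₂[R * sin α * cos φ, R * sin α * sin φ, R * cos α]‖⁻¹ •
        !₂[R * sin α * cos φ, R * sin α * sin φ, R * cos α]))
        ‖!₂[R * sin α * cos φ, R * sin α * sin φ, R * cos α]‖) =
      (ENNReal.ofReal (sin α) * F (spherePoint ((1 - cos α) / 2, φ))) *
        (Iio (1 : ℝ)).indicator (fun R => ENNReal.ofReal (R ^ 2)) R := by
    intro R hR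
    have hR : 0 < R := hR
    have hn : ‖!₂[R * sin α * cos φ, R * sin α * sin φ, R * cos α]‖ = R := by
      rw [EuclideanSpace.norm_eq, sqrt_eq_iff_mul_self_eq (by positivity) hR.le]
      simp only [Fin.sum_univ_three, Real.norm_eq_abs, sq_abs]
      simp
      linear_combination (R ^ 2 * sin α ^ 2) * sin_sq_add_cos_sq φ + R ^ 2 * sin_sq_add_cos_sq α
    rw [hn]
    have hv : R⁻¹ • !₂[R * sin α * cos φ, R * sin α * sin φ, R * cos α] =
        spherePoint ((1 - cos α) / 2, φ) := by
      rw [spherePoint, hsq]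
      ext i
      fin_cases i <;> simp <;> field_simp
      ring
    rw [hv]
    by_cases h : R ∈ Iio (1 : ℝ)
    · rw [indicator_of_mem h, indicator_of_mem h, ENNReal.ofReal_mul hR.le, sq,
        ENNReal.ofReal_mul hR.le]
      ring
    · rw [indicator_of_notMem h, indicator_of_notMem h]
      simp
  rw [setLIntegral_congr_fun measurableSet_Ioi h1, lintegral_const_mul]
  swap
  · exact Measurable.indicator (by fun_prop) measurableSet_Iio
  have h2 : ∫⁻ R in Ioi (0 : ℝ), (Iio (1 : ℝ)).indicator (fun R => ENNReal.ofReal (R ^ 2)) R =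
      ENNReal.ofReal (1 / 3) := by
    rw [setLIntegral_indicator measurableSet_Iio, inter_comm, Ioi_inter_Iio,
      Measure.restrict_congr_set Ioo_ae_eq_Ioc, ← ofReal_integral_eq_lintegral_ofReal
      (intervalIntegral.intervalIntegrable_pow _).1, ← intervalIntegral.integral_of_le (by norm_num)]
    · norm_num
    · exact ae_of_all _ fun R => sq_nonneg R
  have h3 : (3 : ENNReal) * ENNReal.ofReal (1 / 3) = 1 := by
    rw [← ENNReal.ofReal_ofNat, ← ENNReal.ofReal_mul (by norm_num)]; norm_num
  rw [h2, mul_comm, mul_assoc, mul_comm (ENNReal.ofReal (1 / 3)), h3, mul_one]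

-- The pushforward form transfers Bochner integrals as well, with measurability of the integrand as
-- the only requirement.
open Set Real in
theorem map_val_surfaceMeasure :
    surfaceMeasure.map Subtype.val = ((2 : ENNReal) •
      ((volume.restrict (Ioo (0 : ℝ) 1)).prod (volume.restrict (Ioo (-π) π)))).map spherePoint := by
  refine Measure.ext_of_lintegral _ fun F hF => ?_
  rw [lintegral_map hF measurable_subtype_coe, lintegral_map hF measurable_spherePoint,
    lintegral_smul_measure, lintegral_surfaceMeasure F hF, smul_eq_mul,
    lintegral_prod_symm (fun p => F (spherePoint p)) (hF.comp measurable_spherePoint).aemeasurable]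

open Set Real in
theorem integral_surfaceMeasure {f : EuclideanSpace ℝ (Fin 3) → ℂ} (hf : Measurable f) :
    ∫ x, f x.1 ∂surfaceMeasure = 2 * ∫ p, f (spherePoint p)
      ∂(volume.restrict (Ioo (0 : ℝ) 1)).prod (volume.restrict (Ioo (-π) π)) := by
  rw [← integral_map (φ := Subtype.val) measurable_subtype_coe.aemeasurable hf.aestronglyMeasurable,
    map_val_surfaceMeasure, integral_map measurable_spherePoint.aemeasurable hf.aestronglyMeasurable,
    integral_smul_measure]
  simp

instance : IsFiniteMeasure surfaceMeasure := by
  unfold surfaceMeasure; infer_instance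

/-- The surface measure is invariant under isometries of the ambient space. -/
theorem lintegral_surfaceMeasure_comp_isometry (F : EuclideanSpace ℝ (Fin 3) → ENNReal)
    (hF : Measurable F) (e : EuclideanSpace ℝ (Fin 3) ≃ₗᵢ[ℝ] EuclideanSpace ℝ (Fin 3)) :
    ∫⁻ x, F (e x.1) ∂surfaceMeasure = ∫⁻ x, F x.1 ∂surfaceMeasure := by
  have he : Measurable e := e.continuous.measurable
  rw [lintegral_surfaceMeasure_eq_ball F hF, lintegral_surfaceMeasure_eq_ball (fun x => F (e x))
    (hF.comp he)]
  congr 1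
  have hm : Measurable fun y : EuclideanSpace ℝ (Fin 3) =>
      (Set.Iio (1 : ℝ)).indicator (fun _ => F (‖y‖⁻¹ • y)) ‖y‖ := by
    have hS : MeasurableSet {y : EuclideanSpace ℝ (Fin 3) | ‖y‖ < 1} :=
      measurableSet_lt measurable_norm measurable_const
    exact (show Measurable fun y : EuclideanSpace ℝ (Fin 3) => F (‖y‖⁻¹ • y) by fun_prop).indicator hS
  rw [← e.measurePreserving.lintegral_comp hm]
  simp

-- Archimedes' theorem: a reflection moves the centre `x` to the north pole, where a quarter of the
-- squared chordal distance is the coordinate `t` itself.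
open Set Real in
theorem map_dist_sq_surfaceMeasure (x : Sphere2) :
    surfaceMeasure.map (fun y => dist x y ^ 2 / 4) =
      ENNReal.ofReal (4 * π) • volume.restrict (Ioo (0 : ℝ) 1) := by
  refine Measure.ext_of_lintegral _ fun F hF => ?_
  rw [lintegral_map hF (by fun_prop), lintegral_smul_measure, smul_eq_mul]
  let n : EuclideanSpace ℝ (Fin 3) := !₂[0, 0, 1]
  have hn : ‖n‖ = 1 := by
    rw [EuclideanSpace.norm_eq, sqrt_eq_one]
    simp [n, Fin.sum_univ_three]
  have hx : ‖n‖ = ‖x.1‖ := by rw [hn]; simp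
  let e : EuclideanSpace ℝ (Fin 3) ≃ₗᵢ[ℝ] EuclideanSpace ℝ (Fin 3) :=
    Submodule.reflection (Submodule.span ℝ {n - x.1})ᗮ
  have he : e n = x.1 := Submodule.reflection_sub hx
  have h1 : ∫⁻ y, F (dist x y ^ 2 / 4) ∂surfaceMeasure =
      ∫⁻ y, F (dist n y.1 ^ 2 / 4) ∂surfaceMeasure := by
    refine (lintegral_surfaceMeasure_comp_isometry (fun z => F (dist x.1 z ^ 2 / 4))
      (by fun_prop) e).symm.trans ?_
    refine lintegral_congr fun y => ?_
    rw [← he, e.dist_map]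
  rw [h1, lintegral_surfaceMeasure (fun z => F (dist n z ^ 2 / 4)) (by fun_prop)]
  have h2 : ∀ φ, ∫⁻ t in Ioo (0 : ℝ) 1, F (dist n (spherePoint (t, φ)) ^ 2 / 4) =
      ∫⁻ t in Ioo (0 : ℝ) 1, F t := by
    intro φ
    refine setLIntegral_congr_fun measurableSet_Ioo fun t ht => ?_
    have h0 : 0 ≤ t * (1 - t) := mul_nonneg ht.1.le (by linarith [ht.2])
    congr 1
    rw [EuclideanSpace.dist_eq, sq_sqrt (by positivity)]
    simp only [Fin.sum_univ_three, Real.dist_eq, sq_abs, n, spherePoint]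
    simp
    linear_combination (t * (1 - t)) * sin_sq_add_cos_sq φ +
      (cos φ ^ 2 + sin φ ^ 2) * sq_sqrt h0
  simp only [h2]
  rw [setLIntegral_const, volume_Ioo, mul_comm _ (ENNReal.ofReal _), ← mul_assoc,
    ← ENNReal.ofReal_ofNat, ← ENNReal.ofReal_mul (by norm_num)]
  congr 2
  ring

open Set Real in
theorem integral_comp_dist_sq_surfaceMeasure (x : Sphere2) {f : ℝ → ℝ} (hf : Measurable f) :
    ∫ y, f (dist x y ^ 2 / 4) ∂surfaceMeasure = 4 * π * ∫ t in Ioo (0 : ℝ) 1, f t := by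
  rw [← integral_map (φ := fun y => dist x y ^ 2 / 4) (by fun_prop) hf.aestronglyMeasurable,
    map_dist_sq_surfaceMeasure, integral_smul_measure, ENNReal.toReal_ofReal (by positivity),
    smul_eq_mul]

open Real in
theorem surfaceMeasure_real_univ : surfaceMeasure.real Set.univ = 4 * π := by
  let x : Sphere2 := ⟨!₂[0, 0, 1], by
    rw [mem_sphere_zero_iff_norm, EuclideanSpace.norm_eq, sqrt_eq_one]
    simp [Fin.sum_univ_three]⟩
  have := integral_comp_dist_sq_surfaceMeasure x (f := fun _ => 1) measurable_const
  simpa using this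

/-! ### Hermitian product and Hopf map -/

theorem sphere3_norm_sq (p : Sphere3) : ‖p.1 0‖ ^ 2 + ‖p.1 1‖ ^ 2 = 1 := by
  simpa [Complex.normSq_eq_norm_sq] using sphere3_normSq p

/-- The Hermitian product of two points of `S³`. -/
noncomputable def herm (p q : Sphere3) : ℂ :=
  p.1 0 * (starRingEnd ℂ) (q.1 0) + p.1 1 * (starRingEnd ℂ) (q.1 1)

/-- Lagrange's identity for two unit vectors of `ℂ²`. -/
theorem norm_herm_sq_add (p q : Sphere3) :
    ‖herm p q‖ ^ 2 + ‖p.1 1 * q.1 0 - q.1 1 * p.1 0‖ ^ 2 = 1 := by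
  have hp := sphere3_normSq p
  have hq := sphere3_normSq q
  simp only [herm, ← Complex.normSq_eq_norm_sq, Complex.normSq_apply, Complex.add_re, Complex.add_im,
    Complex.mul_re, Complex.mul_im, Complex.conj_re, Complex.conj_im, Complex.sub_re,
    Complex.sub_im] at *
  linear_combination ((q.1 0).re * (q.1 0).re + (q.1 0).im * (q.1 0).im +
    ((q.1 1).re * (q.1 1).re + (q.1 1).im * (q.1 1).im)) * hp + hq

theorem dist_hopfMap_sq (p q : Sphere3) :
    dist (hopfMap p) (hopfMap q) ^ 2 = 4 * ‖p.1 1 * q.1 0 - q.1 1 * p.1 0‖ ^ 2 := by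
  have hp := sphere3_normSq p
  have hq := sphere3_normSq q
  rw [Subtype.dist_eq, EuclideanSpace.dist_eq, Real.sq_sqrt (by positivity)]
  simp only [hopfMap, Fin.sum_univ_three, Real.dist_eq, sq_abs, ← Complex.normSq_eq_norm_sq,
    Complex.normSq_apply, Complex.sub_re, Complex.sub_im, Complex.mul_re, Complex.mul_im,
    Complex.conj_re, Complex.conj_im, Matrix.cons_val_zero, Matrix.cons_val_one,
    Matrix.cons_val] at *
  generalize (p.1 0).re = a, (p.1 0).im = b, (p.1 1).re = c, (p.1 1).im = d at *
  generalize (q.1 0).re = a', (q.1 0).im = b', (q.1 1).re = c', (q.1 1).im = d' at *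
  -- Off the sphere the two sides differ by `(|p|² - |q|²)²`; one factor serves as coefficient, the
  -- other is `hp - hq`.
  linear_combination (a * a + b * b + (c * c + d * d) - (a' * a' + b' * b' + (c' * c' + d' * d'))) *
    (hp - hq)

/-! ### Two-point functions of determinantal densities -/

/-- Bounded measurable complex-valued functions. -/
def BoundedMeasurable {X : Type*} [MeasurableSpace X] (f : X → ℂ) : Prop :=
  Measurable f ∧ ∃ C, ∀ x, ‖f x‖ ≤ C

namespace BoundedMeasurable

variable {X Y : Type*} [MeasurableSpace X] [MeasurableSpace Y] {f g : X → ℂ}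

theorem const (c : ℂ) : BoundedMeasurable fun _ : X => c :=
  ⟨measurable_const, ‖c‖, fun _ => le_rfl⟩

theorem mul (hf : BoundedMeasurable f) (hg : BoundedMeasurable g) :
    BoundedMeasurable fun x => f x * g x := by
  obtain ⟨C, hC⟩ := hf.2
  obtain ⟨D, hD⟩ := hg.2
  refine ⟨hf.1.mul hg.1, C * D, fun x => ?_⟩
  rw [norm_mul]
  exact mul_le_mul (hC x) (hD x) (norm_nonneg _) ((norm_nonneg _).trans (hC x))

theorem sub (hf : BoundedMeasurable f) (hg : BoundedMeasurable g) :
    BoundedMeasurable fun x => f x - g x := by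
  obtain ⟨C, hC⟩ := hf.2
  obtain ⟨D, hD⟩ := hg.2
  exact ⟨hf.1.sub hg.1, C + D, fun x => (norm_sub_le _ _).trans (add_le_add (hC x) (hD x))⟩

theorem star (hf : BoundedMeasurable f) : BoundedMeasurable fun x => (starRingEnd ℂ) (f x) := by
  obtain ⟨C, hC⟩ := hf.2
  exact ⟨Complex.continuous_conj.measurable.comp hf.1, C, fun x => by simpa using hC x⟩

theorem pow (hf : BoundedMeasurable f) (n : ℕ) : BoundedMeasurable fun x => f x ^ n := by
  induction n with
  | zero => simpa using const 1
  | succ n ih => simpa [pow_succ] using ih.mul hf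

theorem comp {e : Y → X} (hf : BoundedMeasurable f) (he : Measurable e) :
    BoundedMeasurable fun y => f (e y) :=
  ⟨hf.1.comp he, hf.2.imp fun _ hC y => hC (e y)⟩

theorem prod {ι : Type*} {s : Finset ι} {f : ι → X → ℂ} (hf : ∀ i, BoundedMeasurable (f i)) :
    BoundedMeasurable fun x => ∏ i ∈ s, f i x := by
  classical
  induction s using Finset.induction_on with
  | empty => simpa using const 1
  | insert a s ha ih => simpa [Finset.prod_insert ha] using (hf a).mul ih

theorem integrable (hf : BoundedMeasurable f) (μ : Measure X) [IsFiniteMeasure μ] :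
    Integrable f μ := by
  obtain ⟨C, hC⟩ := hf.2
  exact Integrable.of_bound hf.1.aestronglyMeasurable C (ae_of_all _ hC)

end BoundedMeasurable

section Determinantal

variable {X : Type*} [MeasurableSpace X]

/-- Only the variables `i` and `j` are coupled, through `g`. Coordinate `i` is split off, and for
its fixed value `g` is absorbed into the factor of coordinate `j`, leaving a product integral. -/
theorem integral_pi_two_point (μ : Measure X) [IsFiniteMeasure μ] {n : ℕ} {f : Fin n → X → ℂ}
    (hf : ∀ l, BoundedMeasurable (f l)) {g : X × X → ℂ} (hg : BoundedMeasurable g) {i j : Fin n}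
    (hij : i ≠ j) :
    ∫ x, g (x i, x j) * ∏ l, f l (x l) ∂(Measure.pi fun _ => μ) =
      (∏ l, if l = i ∨ l = j then 1 else ∫ x, f l x ∂μ) *
        ∫ p, g p * (f i p.1 * f j p.2) ∂μ.prod μ := by
  obtain _ | n := n
  · exact i.elim0
  obtain ⟨j, rfl⟩ := Fin.exists_succAbove_eq hij.symm
  have hmp := measurePreserving_piFinSuccAbove (fun _ : Fin (n + 1) => μ) i
  rw [← hmp.symm.integral_comp']
  have hF : BoundedMeasurable fun p : X × (Fin n → X) =>
      g (p.1, p.2 j) * (f i p.1 * ∏ l, f (i.succAbove l) (p.2 l)) := by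
    refine (hg.comp (by fun_prop)).mul (((hf i).comp measurable_fst).mul (BoundedMeasurable.prod ?_))
    exact fun l => (hf _).comp (by fun_prop)
  have h1 : ∀ p : X × (Fin n → X), g ((MeasurableEquiv.piFinSuccAbove (fun _ => X) i).symm p i,
      (MeasurableEquiv.piFinSuccAbove (fun _ => X) i).symm p (i.succAbove j)) *
      ∏ l, f l ((MeasurableEquiv.piFinSuccAbove (fun _ => X) i).symm p l) =
      g (p.1, p.2 j) * (f i p.1 * ∏ l, f (i.succAbove l) (p.2 l)) := by
    intro p
    have e1 : (MeasurableEquiv.piFinSuccAbove (fun _ => X) i).symm p i = p.1 :=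
      Fin.insertNth_apply_same (α := fun _ => X) i p.1 p.2
    have e2 : ∀ l, (MeasurableEquiv.piFinSuccAbove (fun _ => X) i).symm p (i.succAbove l) = p.2 l :=
      Fin.insertNth_apply_succAbove (α := fun _ => X) i p.1 p.2
    rw [Fin.prod_univ_succAbove _ i]
    simp only [e1, e2]
  simp only [h1]
  rw [integral_prod _ (hF.integrable _), integral_prod]
  swap
  · exact (hg.mul (((hf _).comp measurable_fst).mul ((hf _).comp measurable_snd))).integrable _
  rw [← integral_const_mul]
  refine integral_congr_ae (ae_of_all _ fun a => ?_)
  have h2 : ∀ y : Fin n → X, g (a, y j) * (f i a * ∏ l, f (i.succAbove l) (y l)) =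
      f i a * ∏ l, (if l = j then g (a, y l) else 1) * f (i.succAbove l) (y l) := by
    intro y
    rw [Finset.prod_mul_distrib, Finset.prod_ite_eq' Finset.univ j]
    simp only [Finset.mem_univ, if_true]
    ring
  simp only [h2]
  rw [integral_const_mul, integral_fintype_prod_eq_prod
    (f := fun l y => (if l = j then g (a, y) else 1) * f (i.succAbove l) y),
    Fin.prod_univ_succAbove _ i]
  simp only [true_or, if_true, one_mul, Fin.succAbove_ne, false_or, Fin.succAbove_right_inj]
  rw [Fintype.prod_eq_mul_prod_compl j, Fintype.prod_eq_mul_prod_compl j]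
  simp only [if_true, one_mul]
  have h3 : ∏ l ∈ {j}ᶜ, ∫ y, (if l = j then g (a, y) else 1) * f (i.succAbove l) y ∂μ =
      ∏ l ∈ {j}ᶜ, if l = j then 1 else ∫ x, f (i.succAbove l) x ∂μ := by
    refine Finset.prod_congr rfl fun l hl => ?_
    have : l ≠ j := by simpa using hl
    simp [this]
  rw [h3]
  have h4 : ∫ y, g (a, y) * (f i a * f (i.succAbove j) y) ∂μ =
      f i a * ∫ y, g (a, y) * f (i.succAbove j) y ∂μ := by
    rw [← integral_const_mul]
    congr 1
    ext y
    ring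
  rw [h4]
  ring

theorem Equiv.Perm.eq_one_or_eq_swap {α : Type*} [DecidableEq α] {i j : α} {π : Equiv.Perm α}
    (h : ∀ l, ¬(l = i ∨ l = j) → π l = l) : π = 1 ∨ π = Equiv.swap i j := by
  have h2 : ∀ a, (a = i ∨ a = j) → (π a = i ∨ π a = j) := by
    intro a ha
    by_contra hc
    have := π.injective (h _ hc)
    rw [this] at hc
    exact hc ha
  have hinj := π.injective
  by_cases hi : π i = i
  · left
    ext l
    by_cases hl : l = i ∨ l = j
    · rcases hl with rfl | rfl
      · exact hi
      · rcases h2 l (Or.inr rfl) with h3 | h3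
        · have := hinj (h3.trans hi.symm)
          subst this
          exact hi
        · exact h3
    · exact h l hl
  · right
    have hi' : π i = j := (h2 i (Or.inl rfl)).resolve_left hi
    ext l
    by_cases hl : l = i ∨ l = j
    · rcases hl with rfl | rfl
      · simpa using hi'
      · rw [Equiv.swap_apply_right]
        refine (h2 l (Or.inr rfl)).resolve_right fun h3 => ?_
        have := hinj (h3.trans hi'.symm)
        subst this
        exact hi h3
    · rw [h l hl, Equiv.swap_apply_of_ne_of_ne (by tauto) (by tauto)]

/-- Write `τ = σ * π`. The product forces `π` to fix every index other than `i, j`, so `π` is the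
identity or the transposition, with signs `1` and `-1`. -/
theorem sum_perm_sign_two_point {n : ℕ} {i j : Fin n} (hij : i ≠ j)
    (σ : Equiv.Perm (Fin n)) (T : Fin n → Fin n → ℂ) :
    ∑ τ : Equiv.Perm (Fin n), ((Equiv.Perm.sign σ : ℤ) : ℂ) * ((Equiv.Perm.sign τ : ℤ) : ℂ) *
      ((∏ l, if l = i ∨ l = j then 1 else if σ l = τ l then 1 else 0) * T (τ i) (τ j)) =
      T (σ i) (σ j) - T (σ j) (σ i) := by
  rw [← Equiv.sum_comp (Equiv.mulLeft σ)]
  have hne : (1 : Equiv.Perm (Fin n)) ≠ Equiv.swap i j := fun h => by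
    have := congrArg (fun e => e i) h
    simp only [Equiv.Perm.one_apply, Equiv.swap_apply_left] at this
    exact hij this
  rw [← Finset.sum_subset (Finset.subset_univ {1, Equiv.swap i j}), Finset.sum_pair hne]
  · have hs : ((Equiv.Perm.sign σ : ℤ) : ℂ) * ((Equiv.Perm.sign σ : ℤ) : ℂ) = 1 := by
      rcases Int.units_eq_one_or (Equiv.Perm.sign σ) with h | h <;> simp [h]
    have hp1 : (∏ l, if l = i ∨ l = j then (1 : ℂ) else
        if σ l = (Equiv.mulLeft σ 1) l then 1 else 0) = 1 :=
      Finset.prod_eq_one fun l _ => by simp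
    have hp2 : (∏ l, if l = i ∨ l = j then (1 : ℂ) else
        if σ l = (Equiv.mulLeft σ (Equiv.swap i j)) l then 1 else 0) = 1 := by
      refine Finset.prod_eq_one fun l _ => ?_
      split_ifs with h1 h2
      · rfl
      · rfl
      · refine absurd ?_ h2
        rw [Equiv.coe_mulLeft, Equiv.Perm.mul_apply,
          Equiv.swap_apply_of_ne_of_ne (by tauto) (by tauto)]
    rw [hp1, hp2]
    simp only [Equiv.coe_mulLeft, Equiv.Perm.mul_apply, Equiv.swap_apply_left,
      Equiv.swap_apply_right, mul_one, Equiv.Perm.sign_mul,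
      Equiv.Perm.sign_swap hij]
    push_cast
    linear_combination (T (σ i) (σ j) - T (σ j) (σ i)) * hs
  · intro π _ hπ
    have : ∃ l, ¬(l = i ∨ l = j) ∧ π l ≠ l := by
      by_contra hc
      push Not at hc
      rcases Equiv.Perm.eq_one_or_eq_swap (fun l hl => hc l (not_or.1 hl)) with h | h <;> simp [h] at hπ
    obtain ⟨l, hl, hl2⟩ := this
    rw [Finset.prod_eq_zero (Finset.mem_univ l)]
    · simp
    · rw [if_neg hl, if_neg]
      rw [Equiv.coe_mulLeft, Equiv.Perm.mul_apply]
      exact fun h => hl2 (σ.injective h).symm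

/-- The slice of the two-point correlation of an orthonormal family. -/
noncomputable def pairIntegral (μ : Measure X) {n : ℕ} (ψ : Fin n → X → ℂ) (g : X × X → ℂ)
    (a b : Fin n) : ℂ :=
  ∫ p, g p * ((ψ a p.1 * (starRingEnd ℂ) (ψ a p.1)) * (ψ b p.2 * (starRingEnd ℂ) (ψ b p.2))) ∂μ.prod μ -
  ∫ p, g p * ((ψ a p.1 * (starRingEnd ℂ) (ψ b p.1)) * (ψ b p.2 * (starRingEnd ℂ) (ψ a p.2))) ∂μ.prod μ

theorem det_mul_star_det {X : Type*} {n : ℕ} (ψ : Fin n → X → ℂ) (x : Fin n → X) :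
    (Matrix.of fun a i => ψ a (x i)).det * (starRingEnd ℂ) (Matrix.of fun a i => ψ a (x i)).det =
    ∑ σ : Equiv.Perm (Fin n), ∑ τ : Equiv.Perm (Fin n),
      ((Equiv.Perm.sign σ : ℤ) : ℂ) * ((Equiv.Perm.sign τ : ℤ) : ℂ) *
        ∏ l, ψ (σ l) (x l) * (starRingEnd ℂ) (ψ (τ l) (x l)) := by
  rw [Matrix.det_apply', map_sum, Finset.sum_mul_sum]
  refine Finset.sum_congr rfl fun σ _ => Finset.sum_congr rfl fun τ _ => ?_
  rw [Finset.prod_mul_distrib, map_mul, map_prod]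
  simp
  ring

variable (μ : Measure X) [IsFiniteMeasure μ] {n : ℕ} {ψ : Fin n → X → ℂ}

/-- In the double Leibniz expansion, integrating out the variables other than `x i, x j` leaves, by
orthonormality, only those `τ` that agree with `σ` off `{i, j}`. -/
theorem integral_two_point_mul_det (hψ : ∀ a, BoundedMeasurable (ψ a))
    (horth : ∀ a b, ∫ x, ψ a x * (starRingEnd ℂ) (ψ b x) ∂μ = if a = b then 1 else 0)
    {g : X × X → ℂ} (hg : BoundedMeasurable g) {i j : Fin n} (hij : i ≠ j) :
    ∫ x : Fin n → X, g (x i, x j) * ((Matrix.of fun a i => ψ a (x i)).det *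
      (starRingEnd ℂ) (Matrix.of fun a i => ψ a (x i)).det) ∂(Measure.pi fun _ => μ) =
    ∑ σ : Equiv.Perm (Fin n), pairIntegral μ ψ g (σ i) (σ j) := by
  have hf : ∀ (σ τ : Equiv.Perm (Fin n)) (l : Fin n),
      BoundedMeasurable fun y => ψ (σ l) y * (starRingEnd ℂ) (ψ (τ l) y) :=
    fun σ τ l => (hψ _).mul (hψ _).star
  have hint : ∀ σ τ : Equiv.Perm (Fin n), Integrable (fun x : Fin n → X => g (x i, x j) *
      (((Equiv.Perm.sign σ : ℤ) : ℂ) * ((Equiv.Perm.sign τ : ℤ) : ℂ) *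
        ∏ l, ψ (σ l) (x l) * (starRingEnd ℂ) (ψ (τ l) (x l)))) (Measure.pi fun _ => μ) := by
    intro σ τ
    refine BoundedMeasurable.integrable ((hg.comp (by fun_prop)).mul
      ((BoundedMeasurable.const _).mul (BoundedMeasurable.prod fun l =>
        (hf σ τ l).comp (measurable_pi_apply l)))) _
  simp only [det_mul_star_det, Finset.mul_sum]
  rw [integral_finsetSum _ fun σ _ => integrable_finsetSum _ fun τ _ => hint σ τ]
  refine Finset.sum_congr rfl fun σ _ => ?_
  rw [integral_finsetSum _ fun τ _ => hint σ τ]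
  rw [pairIntegral, ← sum_perm_sign_two_point hij σ fun b d =>
    ∫ p, g p * ((ψ (σ i) p.1 * (starRingEnd ℂ) (ψ b p.1)) *
      (ψ (σ j) p.2 * (starRingEnd ℂ) (ψ d p.2))) ∂μ.prod μ]
  refine Finset.sum_congr rfl fun τ _ => ?_
  have h1 := integral_pi_two_point μ (hf σ τ) hg hij
  simp only [horth] at h1
  rw [← h1, ← integral_const_mul]
  exact integral_congr_ae (ae_of_all _ fun x => mul_left_comm _ _ _)

/-- Orthonormality kills every pair `σ ≠ τ`, and each of the `n!` diagonal pairs contributes 1. This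
is the normalizing constant. -/
theorem integral_det_mul_star_det (hψ : ∀ a, BoundedMeasurable (ψ a))
    (horth : ∀ a b, ∫ x, ψ a x * (starRingEnd ℂ) (ψ b x) ∂μ = if a = b then 1 else 0) :
    ∫ x : Fin n → X, (Matrix.of fun a i => ψ a (x i)).det *
      (starRingEnd ℂ) (Matrix.of fun a i => ψ a (x i)).det ∂(Measure.pi fun _ => μ) =
    (n.factorial : ℂ) := by
  have hf : ∀ (σ τ : Equiv.Perm (Fin n)) (l : Fin n),
      BoundedMeasurable fun y => ψ (σ l) y * (starRingEnd ℂ) (ψ (τ l) y) :=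
    fun σ τ l => (hψ _).mul (hψ _).star
  have hint : ∀ σ τ : Equiv.Perm (Fin n), Integrable (fun x : Fin n → X =>
      ((Equiv.Perm.sign σ : ℤ) : ℂ) * ((Equiv.Perm.sign τ : ℤ) : ℂ) *
        ∏ l, ψ (σ l) (x l) * (starRingEnd ℂ) (ψ (τ l) (x l))) (Measure.pi fun _ => μ) := by
    intro σ τ
    exact BoundedMeasurable.integrable ((BoundedMeasurable.const _).mul
      (BoundedMeasurable.prod fun l => (hf σ τ l).comp (measurable_pi_apply l))) _
  simp only [det_mul_star_det]
  rw [integral_finsetSum _ fun σ _ => integrable_finsetSum _ fun τ _ => hint σ τ]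
  have h1 : ∀ σ : Equiv.Perm (Fin n), ∫ x : Fin n → X, ∑ τ : Equiv.Perm (Fin n),
      ((Equiv.Perm.sign σ : ℤ) : ℂ) * ((Equiv.Perm.sign τ : ℤ) : ℂ) *
        ∏ l, ψ (σ l) (x l) * (starRingEnd ℂ) (ψ (τ l) (x l)) ∂(Measure.pi fun _ => μ) = 1 := by
    intro σ
    rw [integral_finsetSum _ fun τ _ => hint σ τ, Finset.sum_eq_single σ]
    · rw [integral_const_mul, integral_fintype_prod_eq_prod
        (f := fun l y => ψ (σ l) y * (starRingEnd ℂ) (ψ (σ l) y))]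
      simp only [horth, if_true, Finset.prod_const_one, mul_one]
      rcases Int.units_eq_one_or (Equiv.Perm.sign σ) with h | h <;> simp [h]
    · intro τ _ hτ
      have : ∃ l, σ l ≠ τ l := by
        by_contra hc
        push Not at hc
        exact hτ (Equiv.ext fun l => (hc l).symm)
      obtain ⟨l, hl⟩ := this
      rw [integral_const_mul, integral_fintype_prod_eq_prod
        (f := fun l y => ψ (σ l) y * (starRingEnd ℂ) (ψ (τ l) y)),
        Finset.prod_eq_zero (Finset.mem_univ l), mul_zero]
      rw [horth, if_neg hl]
    · simp
  simp [h1, Fintype.card_perm]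

/-- The two-point function of the determinantal ensemble with an orthonormal family `ψ`. -/
theorem sum_integral_two_point_mul_det (hψ : ∀ a, BoundedMeasurable (ψ a))
    (horth : ∀ a b, ∫ x, ψ a x * (starRingEnd ℂ) (ψ b x) ∂μ = if a = b then 1 else 0)
    {g : X × X → ℂ} (hg : BoundedMeasurable g) :
    ∑ i, ∑ j ∈ Finset.univ.erase i,
      ∫ x : Fin n → X, g (x i, x j) * ((Matrix.of fun a i => ψ a (x i)).det *
        (starRingEnd ℂ) (Matrix.of fun a i => ψ a (x i)).det) ∂(Measure.pi fun _ => μ) =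
    (n.factorial : ℂ) * ∫ p, g p * (
      (∑ a, ψ a p.1 * (starRingEnd ℂ) (ψ a p.1)) * (∑ a, ψ a p.2 * (starRingEnd ℂ) (ψ a p.2)) -
      (∑ a, ψ a p.1 * (starRingEnd ℂ) (ψ a p.2)) * (∑ a, ψ a p.2 * (starRingEnd ℂ) (ψ a p.1)))
      ∂μ.prod μ := by
  -- The direct and exchange terms cancel on the diagonal, so sums over distinct pairs extend to all
  -- pairs and factor into products of kernels.
  have h0 : ∀ a, pairIntegral μ ψ g a a = 0 := fun a => by simp [pairIntegral]
  have h1 : ∀ i, ∑ j ∈ Finset.univ.erase i,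
      ∫ x : Fin n → X, g (x i, x j) * ((Matrix.of fun a i => ψ a (x i)).det *
        (starRingEnd ℂ) (Matrix.of fun a i => ψ a (x i)).det) ∂(Measure.pi fun _ => μ) =
      ∑ j, ∑ σ : Equiv.Perm (Fin n), pairIntegral μ ψ g (σ i) (σ j) := by
    intro i
    rw [← Finset.sum_erase_add _ _ (Finset.mem_univ i)]
    simp only [h0, Finset.sum_const_zero, add_zero]
    exact Finset.sum_congr rfl fun j hj =>
      integral_two_point_mul_det μ hψ horth hg (Finset.ne_of_mem_erase hj).symm
  simp only [h1]
  have h2 : ∑ i, ∑ j, ∑ σ : Equiv.Perm (Fin n), pairIntegral μ ψ g (σ i) (σ j) =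
      ∑ σ : Equiv.Perm (Fin n), ∑ a, ∑ b, pairIntegral μ ψ g a b := by
    simp only [Finset.sum_comm (t := (Finset.univ : Finset (Equiv.Perm (Fin n))))]
    refine Finset.sum_congr rfl fun σ _ => ?_
    refine Eq.trans ?_ (Equiv.sum_comp σ fun a => ∑ b, pairIntegral μ ψ g a b)
    exact Finset.sum_congr rfl fun i _ => Equiv.sum_comp σ fun b => pairIntegral μ ψ g (σ i) b
  rw [h2, Finset.sum_const, Finset.card_univ, Fintype.card_perm, Fintype.card_fin, nsmul_eq_mul]
  congr 1
  have hf : ∀ a b c d : Fin n, Integrable (fun p : X × X => g p * ((ψ a p.1 *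
      (starRingEnd ℂ) (ψ b p.1)) * (ψ c p.2 * (starRingEnd ℂ) (ψ d p.2)))) (μ.prod μ) :=
    fun a b c d => (hg.mul ((((hψ a).mul (hψ b).star).comp measurable_fst).mul
      (((hψ c).mul (hψ d).star).comp measurable_snd))).integrable _
  have h3 : ∀ a b, pairIntegral μ ψ g a b = ∫ p, (g p * ((ψ a p.1 * (starRingEnd ℂ) (ψ a p.1)) *
      (ψ b p.2 * (starRingEnd ℂ) (ψ b p.2))) - g p * ((ψ a p.1 * (starRingEnd ℂ) (ψ b p.1)) *
      (ψ b p.2 * (starRingEnd ℂ) (ψ a p.2)))) ∂μ.prod μ :=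
    fun a b => (integral_sub (hf a a b b) (hf a b b a)).symm
  have h4 : ∀ a b, Integrable (fun p : X × X => g p * ((ψ a p.1 * (starRingEnd ℂ) (ψ a p.1)) *
      (ψ b p.2 * (starRingEnd ℂ) (ψ b p.2))) - g p * ((ψ a p.1 * (starRingEnd ℂ) (ψ b p.1)) *
      (ψ b p.2 * (starRingEnd ℂ) (ψ a p.2)))) (μ.prod μ) :=
    fun a b => (hf a a b b).sub (hf a b b a)
  simp only [h3]
  simp_rw [← integral_finsetSum Finset.univ fun b _ => h4 _ b]
  rw [← integral_finsetSum _ fun a _ => integrable_finsetSum _ fun b _ => h4 a b]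
  congr 1
  ext p
  rw [Finset.sum_mul_sum, Finset.sum_mul_sum, ← Finset.sum_sub_distrib, Finset.mul_sum]
  refine Finset.sum_congr rfl fun a _ => ?_
  rw [← Finset.sum_sub_distrib, Finset.mul_sum]
  exact Finset.sum_congr rfl fun b _ => by ring

end Determinantal

/-! ### The Spherical ensemble as a determinantal ensemble -/

/-- First coordinate of the base point of the Hopf fibre, on the ambient space. -/
noncomputable def baseFst (y : EuclideanSpace ℝ (Fin 3)) : ℂ := (Real.sqrt ((1 - y 2) / 2) : ℂ)

/-- Second coordinate of the base point of the Hopf fibre, on the ambient space. -/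
noncomputable def baseSnd (y : EuclideanSpace ℝ (Fin 3)) : ℂ :=
  if y 2 = 1 then 1 else (⟨y 0, y 1⟩ : ℂ) / (2 * Real.sqrt ((1 - y 2) / 2) : ℝ)

/-- `integral_surfaceMeasure` takes integrands defined on the ambient space; this lemma and the next
put the base point in that form. -/
theorem fibreBasePoint_zero (x : Sphere2) : (fibreBasePoint x).1 0 = baseFst x.1 := by
  by_cases h : x.1 2 = 1 <;> simp [fibreBasePoint, baseFst, h]

theorem fibreBasePoint_one (x : Sphere2) : (fibreBasePoint x).1 1 = baseSnd x.1 := by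
  by_cases h : x.1 2 = 1 <;> simp [fibreBasePoint, baseSnd, h]

theorem measurable_baseFst : Measurable baseFst := by
  unfold baseFst; fun_prop

theorem measurable_baseSnd : Measurable baseSnd := by
  unfold baseSnd
  refine Measurable.ite (measurableSet_eq_fun (by fun_prop) (by fun_prop)) measurable_const ?_
  refine Measurable.div ?_ (by fun_prop)
  have : Measurable fun y : EuclideanSpace ℝ (Fin 3) => Complex.equivRealProd.symm (y 0, y 1) :=
    Complex.measurableEquivRealProd.symm.measurable.comp (by fun_prop)
  exact this

theorem measurable_fibreBasePoint : Measurable fibreBasePoint := by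
  refine Measurable.subtype_mk ?_
  have h : Measurable fun x : Sphere2 =>
      WithLp.toLp 2 (fun i => if i = 0 then baseFst x.1 else baseSnd x.1 : Fin 2 → ℂ) := by
    refine (WithLp.measurable_toLp 2 _).comp (measurable_pi_lambda _ fun i => ?_)
    have := measurable_baseFst
    have := measurable_baseSnd
    split_ifs <;> fun_prop
  convert h using 1
  ext x i
  fin_cases i
  · exact fibreBasePoint_zero x
  · exact fibreBasePoint_one x

theorem baseFst_spherePoint {t φ : ℝ} : baseFst (spherePoint (t, φ)) = (Real.sqrt t : ℂ) := by
  simp [baseFst, spherePoint]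

/-- The base point is `(√t, √(1 - t) e^{iφ})` in these coordinates; the exceptional pole `t = 0` is
excluded. -/
theorem baseSnd_spherePoint {t φ : ℝ} (ht : t ∈ Set.Ioo (0 : ℝ) 1) :
    baseSnd (spherePoint (t, φ)) = (Real.sqrt (1 - t) : ℂ) * Complex.exp (φ * Complex.I) := by
  have h1 : Real.sqrt t ≠ 0 := (Real.sqrt_pos.2 ht.1).ne'
  have h2 : (spherePoint (t, φ)) 2 ≠ 1 := by simp [spherePoint, ht.1.ne']
  rw [baseSnd, if_neg h2]
  have h3 : (1 - (spherePoint (t, φ)) 2) / 2 = t := by simp [spherePoint]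
  have h4 : Real.sqrt (t * (1 - t)) = Real.sqrt t * Real.sqrt (1 - t) := Real.sqrt_mul ht.1.le _
  rw [h3]
  apply Complex.ext
  · rw [Complex.div_ofReal_re, Complex.re_ofReal_mul, Complex.exp_ofReal_mul_I_re]
    simp [spherePoint, h4]
    field_simp
  · rw [Complex.div_ofReal_im, Complex.im_ofReal_mul, Complex.exp_ofReal_mul_I_im]
    simp [spherePoint, h4]
    field_simp

theorem integral_pow_mul_one_sub_pow (a b : ℕ) :
    ∫ t in Set.Ioo (0 : ℝ) 1, (t : ℂ) ^ a * ((1 - t : ℝ) : ℂ) ^ b =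
      (a.factorial * b.factorial : ℂ) / (a + b + 1).factorial := by
  have h := Complex.Gamma_mul_Gamma_eq_betaIntegral (s := a + 1) (t := b + 1)
    (by simp; positivity) (by simp; positivity)
  rw [show (a + 1 + (b + 1) : ℂ) = ((a + b + 1 : ℕ) : ℂ) + 1 by push_cast; ring,
    Complex.Gamma_nat_eq_factorial, Complex.Gamma_nat_eq_factorial,
    Complex.Gamma_nat_eq_factorial] at h
  have h0 : (((a + b + 1).factorial : ℕ) : ℂ) ≠ 0 := by exact_mod_cast Nat.factorial_ne_zero _
  rw [eq_div_iff h0, h, mul_comm]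
  congr 1
  rw [Complex.betaIntegral, intervalIntegral.integral_of_le zero_le_one,
    Measure.restrict_congr_set Ioo_ae_eq_Ioc]
  simp

theorem integral_exp_int_mul (m : ℤ) :
    ∫ φ in Set.Ioo (-Real.pi) Real.pi, Complex.exp (m * (φ * Complex.I)) =
      if m = 0 then (2 * Real.pi : ℂ) else 0 := by
  rw [Measure.restrict_congr_set Ioo_ae_eq_Ioc,
    ← intervalIntegral.integral_of_le (by linarith [Real.pi_pos])]
  split_ifs with hm
  · subst hm
    simp
    ring
  · have hc : (m * Complex.I : ℂ) ≠ 0 := mul_ne_zero (by exact_mod_cast hm) Complex.I_ne_zero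
    have := integral_exp_mul_complex (a := -Real.pi) (b := Real.pi) hc
    simp only [show ∀ φ : ℂ, (m : ℂ) * (φ * Complex.I) = m * Complex.I * φ from fun _ => by ring]
    rw [this, div_eq_zero_iff]
    left
    rw [sub_eq_zero, Complex.exp_eq_exp_iff_exists_int]
    exact ⟨m, by push_cast; ring⟩

/-- The integral over `φ` of `e^{i(a-b)φ}` gives orthogonality; for `a = b` the `t`-integral is a
beta integral, which yields the inverse binomial coefficient. -/
theorem integral_base_monomials (n a b : ℕ) (ha : a ≤ n) (hb : b ≤ n) :
    ∫ x : Sphere2, (baseSnd x.1 ^ a * baseFst x.1 ^ (n - a)) *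
      (starRingEnd ℂ) (baseSnd x.1 ^ b * baseFst x.1 ^ (n - b)) ∂surfaceMeasure =
    if a = b then (4 * Real.pi : ℂ) / ((n + 1) * n.choose a) else 0 := by
  have hm : Measurable fun y => (baseSnd y ^ a * baseFst y ^ (n - a)) *
      (starRingEnd ℂ) (baseSnd y ^ b * baseFst y ^ (n - b)) := by
    have := measurable_baseFst
    have := measurable_baseSnd
    exact Measurable.mul (by fun_prop) (Complex.continuous_conj.measurable.comp (by fun_prop))
  rw [integral_surfaceMeasure hm, Measure.prod_restrict]
  have h1 : Set.EqOn (fun p : ℝ × ℝ => (baseSnd (spherePoint p) ^ a * baseFst (spherePoint p) ^ (n - a)) *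
      (starRingEnd ℂ) (baseSnd (spherePoint p) ^ b * baseFst (spherePoint p) ^ (n - b)))
      (fun p => ((Real.sqrt (1 - p.1) : ℂ) ^ (a + b) * (Real.sqrt p.1 : ℂ) ^ (n - a + (n - b))) *
        Complex.exp (((a - b : ℤ) : ℂ) * (p.2 * Complex.I)))
      (Set.Ioo (0 : ℝ) 1 ×ˢ Set.Ioo (-Real.pi) Real.pi) := by
    rintro ⟨t, φ⟩ ⟨ht, -⟩
    simp only
    rw [baseFst_spherePoint, baseSnd_spherePoint ht]
    simp only [map_mul, map_pow, Complex.conj_ofReal, ← Complex.exp_conj, Complex.conj_I, mul_pow,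
      ← Complex.exp_nat_mul, map_natCast]
    rw [show ((a - b : ℤ) : ℂ) * (φ * Complex.I) = a * (φ * Complex.I) + b * (φ * -Complex.I) by
      push_cast; ring, Complex.exp_add]
    ring
  rw [setIntegral_congr_fun (measurableSet_Ioo.prod measurableSet_Ioo) h1, setIntegral_prod_mul
    (f := fun t : ℝ => (Real.sqrt (1 - t) : ℂ) ^ (a + b) * (Real.sqrt t : ℂ) ^ (n - a + (n - b)))
    (g := fun φ : ℝ => Complex.exp (((a - b : ℤ) : ℂ) * (φ * Complex.I))), integral_exp_int_mul]
  split_ifs with h h' h'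
  · subst h'
    have h2 : Set.EqOn (fun t : ℝ => (Real.sqrt (1 - t) : ℂ) ^ (a + a) *
        (Real.sqrt t : ℂ) ^ (n - a + (n - a)))
        (fun t : ℝ => (t : ℂ) ^ (n - a) * ((1 - t : ℝ) : ℂ) ^ a) (Set.Ioo 0 1) := by
      intro t ht
      simp only [← two_mul, pow_mul, ← Complex.ofReal_pow]
      rw [Real.sq_sqrt ht.1.le, Real.sq_sqrt (by linarith [ht.2]), mul_comm]
    rw [setIntegral_congr_fun measurableSet_Ioo h2, integral_pow_mul_one_sub_pow,
      Nat.sub_add_cancel ha, Nat.factorial_succ]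
    have h3 := Nat.choose_mul_factorial_mul_factorial ha
    have h4 : (n.choose a * a.factorial * (n - a).factorial : ℂ) = n.factorial := by
      exact_mod_cast h3
    have h5 : (n.choose a : ℂ) ≠ 0 := by exact_mod_cast (Nat.choose_pos ha).ne'
    have h6 : (n.factorial : ℂ) ≠ 0 := by exact_mod_cast Nat.factorial_ne_zero _
    have h7 : (n + 1 : ℂ) ≠ 0 := by exact_mod_cast Nat.succ_ne_zero n
    push_cast
    field_simp
    linear_combination 4 * h4
  · omega
  · omega
  · simp

/-- The orthonormal family generating the Spherical ensemble of `n` points. -/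
noncomputable def sphericalBasis (n : ℕ) (j : Fin n) (x : Sphere2) : ℂ :=
  (Real.sqrt (n * (n - 1).choose j / (4 * Real.pi)) : ℂ) *
    (baseSnd x.1 ^ (j : ℕ) * baseFst x.1 ^ (n - 1 - j))

theorem boundedMeasurable_baseFst : BoundedMeasurable fun x : Sphere2 => baseFst x.1 := by
  refine ⟨measurable_baseFst.comp measurable_subtype_coe, 1, fun x => ?_⟩
  have := sphere3_norm_sq (fibreBasePoint x)
  rw [fibreBasePoint_zero, fibreBasePoint_one] at this
  nlinarith [norm_nonneg (baseFst x.1), norm_nonneg (baseSnd x.1)]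

theorem boundedMeasurable_baseSnd : BoundedMeasurable fun x : Sphere2 => baseSnd x.1 := by
  refine ⟨measurable_baseSnd.comp measurable_subtype_coe, 1, fun x => ?_⟩
  have := sphere3_norm_sq (fibreBasePoint x)
  rw [fibreBasePoint_zero, fibreBasePoint_one] at this
  nlinarith [norm_nonneg (baseFst x.1), norm_nonneg (baseSnd x.1)]

theorem boundedMeasurable_sphericalBasis (n : ℕ) (j : Fin n) :
    BoundedMeasurable (sphericalBasis n j) :=
  (BoundedMeasurable.const _).mul ((boundedMeasurable_baseSnd.pow _).mul
    (boundedMeasurable_baseFst.pow _))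

theorem sq_ofReal_sqrt_coeff (n k : ℕ) :
    (Real.sqrt (n * (n - 1).choose k / (4 * Real.pi)) : ℂ) *
      (Real.sqrt (n * (n - 1).choose k / (4 * Real.pi)) : ℂ) =
      n * (n - 1).choose k / (4 * Real.pi) := by
  rw [← Complex.ofReal_mul, Real.mul_self_sqrt (by have := Real.pi_pos; positivity)]
  push_cast
  rfl

theorem integral_sphericalBasis_mul_star (n : ℕ) (a b : Fin n) :
    ∫ x, sphericalBasis n a x * (starRingEnd ℂ) (sphericalBasis n b x) ∂surfaceMeasure =
      if a = b then 1 else 0 := by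
  obtain _ | m := n
  · exact a.elim0
  have h := integral_base_monomials m a b (by omega) (by omega)
  have hpt : ∀ x, sphericalBasis (m + 1) a x * (starRingEnd ℂ) (sphericalBasis (m + 1) b x) =
      ((Real.sqrt ((m + 1 : ℕ) * (m + 1 - 1).choose a / (4 * Real.pi)) : ℂ) *
        (Real.sqrt ((m + 1 : ℕ) * (m + 1 - 1).choose b / (4 * Real.pi)) : ℂ)) *
      ((baseSnd x.1 ^ (a : ℕ) * baseFst x.1 ^ (m - a)) *
      (starRingEnd ℂ) (baseSnd x.1 ^ (b : ℕ) * baseFst x.1 ^ (m - b))) := by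
    intro x
    rw [sphericalBasis, sphericalBasis, map_mul, Complex.conj_ofReal, mul_mul_mul_comm]
    rfl
  simp only [hpt]
  rw [integral_const_mul, h]
  by_cases hab : a = b
  · subst hab
    rw [if_pos rfl, if_pos rfl, sq_ofReal_sqrt_coeff, Nat.add_sub_cancel]
    have h5 : (m.choose a : ℂ) ≠ 0 := by exact_mod_cast (Nat.choose_pos (by omega)).ne'
    have h7 : (m + 1 : ℂ) ≠ 0 := by exact_mod_cast Nat.succ_ne_zero m
    have h8 : (Real.pi : ℂ) ≠ 0 := by exact_mod_cast Real.pi_ne_zero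
    push_cast
    field_simp
  · rw [if_neg hab, if_neg (fun h => hab (Fin.ext h)), mul_zero]

/-- The binomial weights in the normalization make the kernel a binomial expansion, hence a pure
power of the Hermitian product. -/
theorem sum_sphericalBasis_mul_star (n : ℕ) (x y : Sphere2) :
    ∑ a, sphericalBasis n a x * (starRingEnd ℂ) (sphericalBasis n a y) =
      n / (4 * Real.pi) * herm (fibreBasePoint x) (fibreBasePoint y) ^ (n - 1) := by
  obtain _ | m := n
  · simp
  have h : ∀ a : Fin (m + 1), sphericalBasis (m + 1) a x * (starRingEnd ℂ) (sphericalBasis (m + 1) a y) =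
      (m + 1) / (4 * Real.pi) * ((baseSnd x.1 * (starRingEnd ℂ) (baseSnd y.1)) ^ (a : ℕ) *
        (baseFst x.1 * (starRingEnd ℂ) (baseFst y.1)) ^ (m - a) * m.choose a) := by
    intro a
    have := sq_ofReal_sqrt_coeff (m + 1) a
    simp only [Nat.add_sub_cancel] at this
    simp only [sphericalBasis, map_mul, map_pow, Complex.conj_ofReal, Nat.add_sub_cancel]
    rw [mul_mul_mul_comm, this]
    push_cast
    ring
  simp only [h]
  rw [← Finset.mul_sum, Fin.sum_univ_eq_sum_range (fun a =>
    (baseSnd x.1 * (starRingEnd ℂ) (baseSnd y.1)) ^ a *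
        (baseFst x.1 * (starRingEnd ℂ) (baseFst y.1)) ^ (m - a) * (m.choose a : ℂ)), ← add_pow,
    herm, fibreBasePoint_zero, fibreBasePoint_one, fibreBasePoint_zero, fibreBasePoint_one,
    add_comm (baseSnd x.1 * _)]
  push_cast
  simp

theorem dist_sq_eq_fibreBasePoint (x y : Sphere2) :
    dist x y ^ 2 = 4 * ‖baseSnd y.1 * baseFst x.1 - baseSnd x.1 * baseFst y.1‖ ^ 2 := by
  have := dist_hopfMap_sq (fibreBasePoint x) (fibreBasePoint y)
  rw [hopfMap_fibreBasePoint, hopfMap_fibreBasePoint, fibreBasePoint_zero, fibreBasePoint_zero,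
    fibreBasePoint_one, fibreBasePoint_one] at this
  rw [this, norm_sub_rev]

/-- The density of the Spherical ensemble is a multiple of `|det|²`. -/
theorem exists_prod_dist_sq_eq_det (n : ℕ) : ∃ C : ℝ, 0 < C ∧ ∀ x : Fin n → Sphere2,
    ((∏ i : Fin n, ∏ j ∈ Finset.Ioi i, dist (x i) (x j) ^ 2 : ℝ) : ℂ) =
      C * ((Matrix.of fun a i => sphericalBasis n a (x i)).det *
        (starRingEnd ℂ) (Matrix.of fun a i => sphericalBasis n a (x i)).det) := by
  let c : Fin n → ℝ := fun a => Real.sqrt (n * (n - 1).choose a / (4 * Real.pi))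
  have hc : ∀ a, 0 < c a := by
    intro a
    have h1 : 0 < n := a.pos
    have h2 : 0 < (n - 1).choose a := Nat.choose_pos (by omega)
    have := Real.pi_pos
    exact Real.sqrt_pos.2 (by positivity)
  have hP : 0 < ∏ a, c a := Finset.prod_pos fun a _ => hc a
  have hQ : (0 : ℝ) < ∏ i : Fin n, ∏ j ∈ Finset.Ioi i, 4 :=
    Finset.prod_pos fun _ _ => Finset.prod_pos fun _ _ => by norm_num
  refine ⟨(∏ i : Fin n, ∏ j ∈ Finset.Ioi i, 4) / (∏ a, c a) ^ 2, by positivity, fun x => ?_⟩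
  -- Up to row scalings this is a homogeneous Vandermonde matrix, whose determinant is a product of
  -- `2 × 2` minors; by `dist_sq_eq_fibreBasePoint` each minor has modulus half a chordal distance.
  have hdet : (Matrix.of fun a i => sphericalBasis n a (x i)).det =
      ((∏ a, c a : ℝ) : ℂ) *
        (Matrix.projVandermonde (fun i => baseSnd (x i).1) (fun i => baseFst (x i).1)).det := by
    rw [← Matrix.det_transpose (Matrix.projVandermonde _ _), Complex.ofReal_prod,
      ← Matrix.det_mul_column]
    congr 1
    ext a i
    simp only [Matrix.of_apply, Matrix.transpose_apply, Matrix.projVandermonde_apply, sphericalBasis,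
      c, Fin.val_rev, show n - (a.1 + 1) = n - 1 - a.1 by omega]
  rw [hdet, Complex.mul_conj, Complex.normSq_mul, Complex.normSq_ofReal, ← Complex.ofReal_mul,
    Matrix.det_projVandermonde]
  congr 1
  simp only [map_prod, Complex.normSq_eq_norm_sq, dist_sq_eq_fibreBasePoint,
    Finset.prod_mul_distrib]
  field_simp

theorem measurable_prod_dist_sq (n : ℕ) : Measurable fun x : Fin n → Sphere2 =>
    ∏ i : Fin n, ∏ j ∈ Finset.Ioi i, dist (x i) (x j) ^ 2 := by
  fun_prop

theorem prod_dist_sq_nonneg {n : ℕ} (x : Fin n → Sphere2) :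
    0 ≤ ∏ i : Fin n, ∏ j ∈ Finset.Ioi i, dist (x i) (x j) ^ 2 :=
  Finset.prod_nonneg fun _ _ => Finset.prod_nonneg fun _ _ => sq_nonneg _

theorem dist_sphere2_le_two (x y : Sphere2) : dist x y ≤ 2 := by
  have := dist_triangle_right x.1 y.1 0
  simp only [dist_zero_right, norm_eq_of_mem_sphere] at this
  rw [Subtype.dist_eq]
  linarith

theorem boundedMeasurable_dist_sq_comp {Ω : Type*} [MeasurableSpace Ω] {f g : Ω → Sphere2}
    (hf : Measurable f) (hg : Measurable g) :
    BoundedMeasurable fun ω => ((dist (f ω) (g ω) ^ 2 : ℝ) : ℂ) := by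
  refine ⟨by fun_prop, 4, fun ω => ?_⟩
  have h1 := dist_sphere2_le_two (f ω) (g ω)
  rw [Complex.norm_real, Real.norm_of_nonneg (sq_nonneg _)]
  nlinarith [dist_nonneg (x := f ω) (y := g ω)]

theorem boundedMeasurable_prod_dist_sq (n : ℕ) : BoundedMeasurable fun x : Fin n → Sphere2 =>
    ((∏ i : Fin n, ∏ j ∈ Finset.Ioi i, dist (x i) (x j) ^ 2 : ℝ) : ℂ) := by
  simp only [Complex.ofReal_prod]
  exact BoundedMeasurable.prod fun i => BoundedMeasurable.prod fun j =>
    boundedMeasurable_dist_sq_comp (measurable_pi_apply i) (measurable_pi_apply j)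

theorem integral_prod_dist_sq_pos (n : ℕ) :
    0 < ∫ x : Fin n → Sphere2, ∏ i : Fin n, ∏ j ∈ Finset.Ioi i, dist (x i) (x j) ^ 2
      ∂(Measure.pi fun _ => surfaceMeasure) := by
  obtain ⟨C, hC, h⟩ := exists_prod_dist_sq_eq_det n
  have h1 := integral_det_mul_star_det surfaceMeasure (boundedMeasurable_sphericalBasis n)
    (integral_sphericalBasis_mul_star n)
  have h2 : ((∫ x : Fin n → Sphere2, ∏ i : Fin n, ∏ j ∈ Finset.Ioi i, dist (x i) (x j) ^ 2
      ∂(Measure.pi fun _ => surfaceMeasure) : ℝ) : ℂ) = ((C * n.factorial : ℝ) : ℂ) := by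
    rw [← integral_complex_ofReal]
    simp only [h]
    rw [integral_const_mul, h1]
    push_cast
    rfl
  rw [Complex.ofReal_inj.1 h2]
  have := Nat.factorial_pos n
  positivity

theorem sphericalWeight_univ (n : ℕ) : sphericalWeight n Set.univ =
    ENNReal.ofReal (∫ x : Fin n → Sphere2, ∏ i : Fin n, ∏ j ∈ Finset.Ioi i, dist (x i) (x j) ^ 2
      ∂(Measure.pi fun _ => surfaceMeasure)) := by
  rw [sphericalWeight, withDensity_apply _ MeasurableSet.univ, setLIntegral_univ,
    ofReal_integral_eq_lintegral_ofReal]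
  · exact ((boundedMeasurable_prod_dist_sq n).integrable _).re
  · exact ae_of_all _ prod_dist_sq_nonneg

instance isProbabilityMeasure_sphericalEnsemble (n : ℕ) :
    IsProbabilityMeasure (sphericalEnsemble n) := by
  refine ⟨?_⟩
  have h := integral_prod_dist_sq_pos n
  rw [sphericalEnsemble, Measure.smul_apply, smul_eq_mul, ENNReal.inv_mul_cancel]
  · rw [sphericalWeight_univ]
    exact (ENNReal.ofReal_pos.2 h).ne'
  · rw [sphericalWeight_univ]
    exact ENNReal.ofReal_ne_top

theorem integral_sphericalEnsemble (n : ℕ) (f : (Fin n → Sphere2) → ℝ) :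
    ∫ x, f x ∂sphericalEnsemble n =
      (∫ x : Fin n → Sphere2, ∏ i : Fin n, ∏ j ∈ Finset.Ioi i, dist (x i) (x j) ^ 2
        ∂(Measure.pi fun _ => surfaceMeasure))⁻¹ *
      ∫ x : Fin n → Sphere2, f x * ∏ i : Fin n, ∏ j ∈ Finset.Ioi i, dist (x i) (x j) ^ 2
        ∂(Measure.pi fun _ => surfaceMeasure) := by
  rw [sphericalEnsemble, integral_smul_measure, sphericalWeight_univ, ENNReal.toReal_inv,
    ENNReal.toReal_ofReal (integral_prod_dist_sq_pos n).le, smul_eq_mul, sphericalWeight,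
    integral_withDensity_eq_integral_toReal_smul (measurable_prod_dist_sq n).ennreal_ofReal
      (ae_of_all _ fun _ => ENNReal.ofReal_lt_top)]
  congr 2
  ext x
  rw [ENNReal.toReal_ofReal (prod_dist_sq_nonneg x), smul_eq_mul, mul_comm]

theorem herm_self (p : Sphere3) : herm p p = 1 := by
  have := sphere3_normSq p
  rw [herm, Complex.mul_conj, Complex.mul_conj, ← Complex.ofReal_add, this, Complex.ofReal_one]

theorem star_herm (p q : Sphere3) : (starRingEnd ℂ) (herm p q) = herm q p := by
  simp [herm, mul_comm]

theorem norm_herm_sq (p q : Sphere3) :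
    ‖herm p q‖ ^ 2 = 1 - dist (hopfMap p) (hopfMap q) ^ 2 / 4 := by
  rw [dist_hopfMap_sq]
  linarith [norm_herm_sq_add p q]

/-- The diagonal values are `n / (4π)` because `herm_self` is 1, and the squared modulus of the
Hermitian product is `1 - dist² / 4`. -/
theorem sphericalBasis_kernel (n : ℕ) (x y : Sphere2) :
    (∑ a, sphericalBasis n a x * (starRingEnd ℂ) (sphericalBasis n a x)) *
      (∑ a, sphericalBasis n a y * (starRingEnd ℂ) (sphericalBasis n a y)) -
    (∑ a, sphericalBasis n a x * (starRingEnd ℂ) (sphericalBasis n a y)) *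
      (∑ a, sphericalBasis n a y * (starRingEnd ℂ) (sphericalBasis n a x)) =
    (((n / (4 * Real.pi)) ^ 2 * (1 - (1 - dist x y ^ 2 / 4) ^ (n - 1)) : ℝ) : ℂ) := by
  have h := norm_herm_sq (fibreBasePoint x) (fibreBasePoint y)
  rw [hopfMap_fibreBasePoint, hopfMap_fibreBasePoint] at h
  simp only [sum_sphericalBasis_mul_star, herm_self]
  have h2 : herm (fibreBasePoint x) (fibreBasePoint y) * herm (fibreBasePoint y) (fibreBasePoint x) =
      ((‖herm (fibreBasePoint x) (fibreBasePoint y)‖ ^ 2 : ℝ) : ℂ) := by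
    rw [← star_herm (fibreBasePoint x), Complex.mul_conj, Complex.normSq_eq_norm_sq]
  rw [← h, mul_mul_mul_comm _ (herm (fibreBasePoint x) (fibreBasePoint y) ^ (n - 1)), ← mul_pow, h2]
  push_cast
  ring

/-- The normalizations `C` and `n!` cancel, and the inner integral over `y` does not depend on `x`,
so the outer one contributes the total area. For `n = 0` the truncated exponent is harmless, as `n ^
2` vanishes. -/
theorem sum_integral_sphericalEnsemble (n : ℕ) {G : ℝ → ℝ} (hG : Measurable G)
    (hb : ∃ C, ∀ t ∈ Set.Icc (0 : ℝ) 1, |G t| ≤ C) :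
    ∑ i, ∑ j ∈ Finset.univ.erase i, ∫ x, G (dist (x i) (x j) ^ 2 / 4) ∂sphericalEnsemble n =
      n ^ 2 * ∫ t in Set.Ioo (0 : ℝ) 1, G t * (1 - (1 - t) ^ (n - 1)) := by
  obtain ⟨C, hC, hdet⟩ := exists_prod_dist_sq_eq_det n
  set Z := ∫ x : Fin n → Sphere2, ∏ i : Fin n, ∏ j ∈ Finset.Ioi i, dist (x i) (x j) ^ 2
        ∂(Measure.pi fun _ => surfaceMeasure) with hZ
  have hZ' : (Z : ℂ) = C * n.factorial := by
    rw [hZ, ← integral_complex_ofReal]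
    simp only [hdet]
    rw [integral_const_mul, integral_det_mul_star_det surfaceMeasure
      (boundedMeasurable_sphericalBasis n) (integral_sphericalBasis_mul_star n)]
  have hbm : BoundedMeasurable fun p : Sphere2 × Sphere2 => ((G (dist p.1 p.2 ^ 2 / 4) : ℝ) : ℂ) := by
    obtain ⟨D, hD⟩ := hb
    refine ⟨by fun_prop, D, fun p => ?_⟩
    rw [Complex.norm_real]
    refine hD _ ⟨by positivity, ?_⟩
    have := norm_herm_sq (fibreBasePoint p.1) (fibreBasePoint p.2)
    rw [hopfMap_fibreBasePoint, hopfMap_fibreBasePoint] at this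
    nlinarith [sq_nonneg ‖herm (fibreBasePoint p.1) (fibreBasePoint p.2)‖]
  have hmain := sum_integral_two_point_mul_det surfaceMeasure (boundedMeasurable_sphericalBasis n)
    (integral_sphericalBasis_mul_star n) hbm
  simp only [sphericalBasis_kernel] at hmain
  have hterm : ∀ i j : Fin n, ((∫ x, G (dist (x i) (x j) ^ 2 / 4) ∂sphericalEnsemble n : ℝ) : ℂ) =
      (n.factorial : ℂ)⁻¹ * ∫ x : Fin n → Sphere2, ((G (dist (x i) (x j) ^ 2 / 4) : ℝ) : ℂ) *
        ((Matrix.of fun a i => sphericalBasis n a (x i)).det *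
        (starRingEnd ℂ) (Matrix.of fun a i => sphericalBasis n a (x i)).det)
        ∂(Measure.pi fun _ => surfaceMeasure) := by
    intro i j
    rw [integral_sphericalEnsemble, ← hZ, Complex.ofReal_mul, ← integral_complex_ofReal,
      Complex.ofReal_inv, hZ']
    simp only [Complex.ofReal_mul, hdet]
    simp only [mul_left_comm _ (C : ℂ)]
    rw [integral_const_mul]
    have : (C : ℂ) ≠ 0 := by exact_mod_cast hC.ne'
    have : (n.factorial : ℂ) ≠ 0 := by exact_mod_cast Nat.factorial_ne_zero n
    field_simp
  have hfac : (n.factorial : ℂ) ≠ 0 := by exact_mod_cast Nat.factorial_ne_zero n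
  rw [← Complex.ofReal_inj, Complex.ofReal_sum]
  simp only [Complex.ofReal_sum, hterm, ← Finset.mul_sum]
  rw [hmain, inv_mul_cancel_left₀ hfac]
  simp only [← Complex.ofReal_mul]
  rw [integral_complex_ofReal]
  congr 1
  rw [integral_prod]
  swap
  · have h1 : BoundedMeasurable fun p : Sphere2 × Sphere2 =>
        ((((n / (4 * Real.pi)) ^ 2 * (1 - (1 - dist p.1 p.2 ^ 2 / 4) ^ (n - 1)) : ℝ)) : ℂ) := by
      have h3 := (boundedMeasurable_dist_sq_comp measurable_fst measurable_snd).mul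
        (BoundedMeasurable.const (X := Sphere2 × Sphere2) 4⁻¹)
      convert (BoundedMeasurable.const (X := Sphere2 × Sphere2) ((n / (4 * Real.pi)) ^ 2)).mul
        ((BoundedMeasurable.const 1).sub (((BoundedMeasurable.const 1).sub h3).pow (n - 1))) using 2
      push_cast
      simp only [div_eq_mul_inv]
    have h4 := ((hbm.mul h1).integrable (surfaceMeasure.prod surfaceMeasure)).re
    simp only [← Complex.ofReal_mul, RCLike.re_to_complex, Complex.ofReal_re] at h4
    exact h4
  simp only
  simp_rw [mul_left_comm (G _), integral_const_mul]
  have h2 : ∀ x : Sphere2, ∫ y, G (dist x y ^ 2 / 4) * (1 - (1 - dist x y ^ 2 / 4) ^ (n - 1))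
      ∂surfaceMeasure = 4 * Real.pi * ∫ t in Set.Ioo (0 : ℝ) 1, G t * (1 - (1 - t) ^ (n - 1)) :=
    fun x => integral_comp_dist_sq_surfaceMeasure x
      (f := fun t => G t * (1 - (1 - t) ^ (n - 1))) (by fun_prop)
  simp only [h2]
  rw [integral_const, surfaceMeasure_real_univ, smul_eq_mul]
  have := Real.pi_pos
  field_simp

/-! ### Mean logarithmic interaction of two fibres -/

theorem dist_sq_sphere3 (p q : Sphere3) : dist p q ^ 2 = 2 - 2 * (herm p q).re := by
  have hp := sphere3_normSq p
  have hq := sphere3_normSq q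
  rw [Subtype.dist_eq, EuclideanSpace.dist_eq, Real.sq_sqrt (by positivity)]
  simp only [Fin.sum_univ_two, dist_eq_norm, ← Complex.normSq_eq_norm_sq, herm,
    Complex.normSq_apply, Complex.sub_re, Complex.sub_im, Complex.mul_re, Complex.add_re,
    Complex.conj_re, Complex.conj_im] at *
  linear_combination hp + hq

theorem fibreRotation_apply (θ : ℝ) (q : Sphere3) (i : Fin 2) :
    (fibreRotation θ q).1 i = Complex.exp (θ * Complex.I) * q.1 i := rfl

theorem fibreRotation_add (s t : ℝ) (q : Sphere3) :
    fibreRotation (s + t) q = fibreRotation s (fibreRotation t q) := by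
  apply Subtype.ext
  ext i
  rw [fibreRotation_apply, fibreRotation_apply, fibreRotation_apply, Complex.ofReal_add, add_mul,
    Complex.exp_add, mul_assoc]

theorem dist_fibreRotation_fibreRotation (s t : ℝ) (q : Sphere3) :
    dist (fibreRotation s q) (fibreRotation t q) =
      ‖Complex.exp (s * Complex.I) - Complex.exp (t * Complex.I)‖ := by
  rw [Subtype.dist_eq, dist_eq_norm, fibreRotation, fibreRotation]
  simp only
  rw [← sub_smul, norm_smul, norm_eq_of_mem_sphere, mul_one]

/-- The distance from `p` to a point of the fibre of `q` as a distance in a plane. -/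
theorem dist_fibreRotation (p q : Sphere3) (θ : ℝ) :
    dist p (fibreRotation θ q) =
      ‖circleMap 0 (Real.sqrt (1 + dist (hopfMap p) (hopfMap q) / 2)) θ -
        herm p q / Real.sqrt (1 + dist (hopfMap p) (hopfMap q) / 2)‖ := by
  have hm := norm_herm_sq p q
  set D := dist (hopfMap p) (hopfMap q) / 2 with hD
  have hD0 : 0 ≤ D := by positivity
  set α := Real.sqrt (1 + D) with hα
  have hα1 : 0 < α := Real.sqrt_pos.2 (by linarith)
  have hα2 : α ^ 2 = 1 + D := Real.sq_sqrt (by linarith)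
  have hm' : ‖herm p q‖ ^ 2 = (1 + D) * (1 - D) := by rw [hm]; simp only [hD]; ring
  rw [← sq_eq_sq₀ dist_nonneg (norm_nonneg _), dist_sq_sphere3, ← Complex.normSq_eq_norm_sq]
  have hh : herm p (fibreRotation θ q) = (starRingEnd ℂ) (Complex.exp (θ * Complex.I)) * herm p q := by
    simp only [herm, fibreRotation_apply, map_mul]
    ring
  rw [hh, circleMap, zero_add, ← Complex.normSq_eq_norm_sq] at *
  have hs := Real.sin_sq_add_cos_sq θ
  simp only [Complex.normSq_apply, Complex.mul_re, Complex.conj_re, Complex.conj_im, Complex.sub_re,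
    Complex.sub_im, Complex.mul_im, Complex.ofReal_re, Complex.ofReal_im, Complex.div_ofReal_re,
    Complex.div_ofReal_im, Complex.exp_ofReal_mul_I_re, Complex.exp_ofReal_mul_I_im] at *
  generalize (herm p q).re = x, (herm p q).im = y at *
  have key : x / α * (x / α) + y / α * (y / α) = 1 - D := by
    field_simp
    rw [hα2]
    linarith
  have e1 : α * (x / α) = x := by field_simp
  have e2 : α * (y / α) = y := by field_simp
  linear_combination (-(α ^ 2)) * hs - hα2 - key + 2 * Real.cos θ * e1 + 2 * Real.sin θ * e2

instance isProbabilityMeasure_uniformAngle : IsProbabilityMeasure uniformAngle := by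
  refine ⟨?_⟩
  have := Real.pi_pos
  rw [uniformAngle, Measure.smul_apply, Measure.restrict_apply_univ, smul_eq_mul,
    ENNReal.inv_mul_cancel]
  · simp [this]
  · simpa using ENNReal.mul_ne_top (by simp) ENNReal.ofReal_ne_top

theorem integral_uniformAngle (f : ℝ → ℝ) :
    ∫ θ, f θ ∂uniformAngle = (2 * Real.pi)⁻¹ * ∫ θ in (0)..(2 * Real.pi), f θ := by
  have := Real.pi_pos
  rw [uniformAngle, integral_smul_measure, intervalIntegral.integral_of_le (by positivity),
    Measure.restrict_congr_set Ico_ae_eq_Ioc, Real.volume_Ico, ENNReal.toReal_inv,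
    ENNReal.toReal_ofReal (by linarith), smul_eq_mul, sub_zero]

theorem integrable_uniformAngle {f : ℝ → ℝ}
    (hf : IntervalIntegrable f volume 0 (2 * Real.pi)) : Integrable f uniformAngle := by
  have := Real.pi_pos
  rw [uniformAngle]
  refine Integrable.smul_measure ?_ (by simp [this])
  rw [Measure.restrict_congr_set Ico_ae_eq_Ioc]
  exact hf.1

theorem integrable_log_dist_fibreRotation (p q : Sphere3) :
    Integrable (fun θ => Real.log (1 / dist p (fibreRotation θ q))) uniformAngle := by
  refine integrable_uniformAngle ?_
  simp only [one_div, Real.log_inv, dist_fibreRotation]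
  refine IntervalIntegrable.neg ?_
  have : MeromorphicOn (fun z => z - herm p q / Real.sqrt (1 + dist (hopfMap p) (hopfMap q) / 2))
      (Metric.sphere 0 |Real.sqrt (1 + dist (hopfMap p) (hopfMap q) / 2)|) :=
    fun z _ => by fun_prop
  exact this.circleIntegrable_log_norm

/-- The centre has modulus `√(1 - D) ≤ √(1 + D)`, so it lies in the disc, where the circle mean of
`log ‖z - c‖` is the logarithm of the radius. -/
theorem integral_log_dist_fibreRotation (p q : Sphere3) :
    ∫ θ, Real.log (1 / dist p (fibreRotation θ q)) ∂uniformAngle =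
      -(1 / 2) * Real.log (1 + dist (hopfMap p) (hopfMap q) / 2) := by
  have hm := norm_herm_sq p q
  have hmem : herm p q / Real.sqrt (1 + dist (hopfMap p) (hopfMap q) / 2) ∈
      Metric.closedBall (0 : ℂ) |Real.sqrt (1 + dist (hopfMap p) (hopfMap q) / 2)| := by
    set D := dist (hopfMap p) (hopfMap q) / 2 with hD
    have hD0 : 0 ≤ D := by positivity
    have hα1 : 0 < Real.sqrt (1 + D) := Real.sqrt_pos.2 (by linarith)
    rw [mem_closedBall_zero_iff, norm_div, Complex.norm_real, Real.norm_eq_abs, abs_of_pos hα1,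
      div_le_iff₀ hα1, Real.mul_self_sqrt (by linarith)]
    nlinarith [norm_nonneg (herm p q), sq_nonneg (dist (hopfMap p) (hopfMap q))]
  have h := circleAverage_log_norm_sub_const_of_mem_closedBall hmem
  rw [Real.circleAverage, smul_eq_mul] at h
  simp only [one_div, Real.log_inv, dist_fibreRotation]
  rw [integral_neg, integral_uniformAngle, h, Real.log_sqrt (by positivity)]
  ring

/-- Fubini's theorem for functions bounded below with controlled sections. -/
theorem integrable_prod_of_section {X Y : Type*} [MeasurableSpace X] [MeasurableSpace Y]
    {μ : Measure X} {ν : Measure Y} [IsProbabilityMeasure μ] [IsProbabilityMeasure ν]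
    {f : X × Y → ℝ} (hf : Measurable f) {c : ℝ} (hc : ∀ p, -c ≤ f p)
    (hs : ∀ x, Integrable (fun y => f (x, y)) ν) {h : X → ℝ} (hh : Integrable h μ)
    (heq : ∀ x, ∫ y, f (x, y) ∂ν = h x) :
    Integrable f (μ.prod ν) ∧ ∫ p, f p ∂μ.prod ν = ∫ x, h x ∂μ := by
  have h1 : Integrable f (μ.prod ν) := by
    -- Adding `c` makes the function nonnegative, so the integral of its norm over a section is the
    -- known value `h x + c`.
    have h2 : Integrable (fun p => f p + c) (μ.prod ν) := by
      rw [integrable_prod_iff (hf.add_const c).aestronglyMeasurable]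
      refine ⟨ae_of_all _ fun x => (hs x).add (integrable_const c), ?_⟩
      have h3 : ∀ x, ∫ y, ‖f (x, y) + c‖ ∂ν = h x + c := by
        intro x
        have hn : ∀ y, ‖f (x, y) + c‖ = f (x, y) + c :=
          fun y => Real.norm_of_nonneg (by linarith [hc (x, y)])
        simp only [hn]
        rw [integral_add (hs x) (integrable_const c), heq]
        simp
      simp only [h3]
      exact hh.add (integrable_const c)
    exact (h2.sub (integrable_const c)).congr (ae_of_all _ fun p => by simp)
  refine ⟨h1, ?_⟩
  rw [integral_prod _ h1]
  simp only [heq]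

theorem measurePreserving_pi_pair {X : Type*} [MeasurableSpace X] (μ : Measure X)
    [IsProbabilityMeasure μ] {n : ℕ} {i j : Fin n} (hij : i ≠ j) :
    MeasurePreserving (fun x : Fin n → X => (x i, x j)) (Measure.pi fun _ => μ) (μ.prod μ) := by
  refine ⟨by fun_prop, ?_⟩
  have h := ProbabilityTheory.iIndepFun_pi (μ := fun _ : Fin n => μ) (X := fun _ x => x)
    (fun _ => aemeasurable_id)
  have h2 := (ProbabilityTheory.indepFun_iff_map_prod_eq_prod_map_map
    (measurable_pi_apply i).aemeasurable (measurable_pi_apply j).aemeasurable).1 (h.indepFun hij)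
  rw [h2, (measurePreserving_eval (fun _ : Fin n => μ) i).map_eq,
    (measurePreserving_eval (fun _ : Fin n => μ) j).map_eq]

theorem measurable_fibreRotation : Measurable fun p : ℝ × Sphere3 => fibreRotation p.1 p.2 := by
  refine Measurable.subtype_mk ?_
  have : Measurable fun p : ℝ × Sphere3 => (Complex.exp (p.1 * Complex.I), p.2.1) := by fun_prop
  exact measurable_smul.comp this

/-- The lower bound that the Fubini argument needs. At coincident points it holds because `Real.log
(1 / 0)` is 0. -/
theorem log_one_div_dist_ge (p q : Sphere3) : -Real.log 2 ≤ Real.log (1 / dist p q) := by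
  rw [one_div, Real.log_inv, neg_le_neg_iff]
  rcases (dist_nonneg (x := p) (y := q)).eq_or_lt with h | h
  · rw [← h, Real.log_zero]
    exact Real.log_nonneg (by norm_num)
  · refine Real.log_le_log h ?_
    have := dist_triangle_right p.1 q.1 0
    simp only [dist_zero_right, norm_eq_of_mem_sphere] at this
    rw [Subtype.dist_eq]
    linarith

/-- The offset `b` is absorbed into the point `q` of the fibre. The mean over the second angle then
depends only on the Hopf images, not on the first angle. -/
theorem log_dist_fibres_uniformAngle {n : ℕ} {i j : Fin n} (hij : i ≠ j) (a b : ℝ) (p q : Sphere3) :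
    Integrable (fun θ : Fin n → ℝ =>
      Real.log (1 / dist (fibreRotation (θ i + a) p) (fibreRotation (θ j + b) q)))
      (Measure.pi fun _ => uniformAngle) ∧
    ∫ θ : Fin n → ℝ, Real.log (1 / dist (fibreRotation (θ i + a) p) (fibreRotation (θ j + b) q))
      ∂(Measure.pi fun _ => uniformAngle) =
      -(1 / 2) * Real.log (1 + dist (hopfMap p) (hopfMap q) / 2) := by
  have hmp := measurePreserving_pi_pair uniformAngle hij
  have hrot := measurable_fibreRotation
  have hf : Measurable fun s : ℝ × ℝ =>
      Real.log (1 / dist (fibreRotation (s.1 + a) p) (fibreRotation (s.2 + b) q)) := by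
    have h1 : Measurable fun s : ℝ × ℝ => fibreRotation (s.1 + a) p :=
      hrot.comp (f := fun s : ℝ × ℝ => (s.1 + a, p)) (by fun_prop)
    have h2 : Measurable fun s : ℝ × ℝ => fibreRotation (s.2 + b) q :=
      hrot.comp (f := fun s : ℝ × ℝ => (s.2 + b, q)) (by fun_prop)
    fun_prop
  have h1 : ∀ s, Integrable (fun t =>
      Real.log (1 / dist (fibreRotation (s + a) p) (fibreRotation (t + b) q))) uniformAngle := by
    intro s
    simp only [fibreRotation_add _ b]
    exact integrable_log_dist_fibreRotation _ _
  have h2 : ∀ s, ∫ t, Real.log (1 / dist (fibreRotation (s + a) p) (fibreRotation (t + b) q))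
      ∂uniformAngle = -(1 / 2) * Real.log (1 + dist (hopfMap p) (hopfMap q) / 2) := by
    intro s
    simp only [fibreRotation_add _ b]
    rw [integral_log_dist_fibreRotation, hopfMap_fibreRotation, hopfMap_fibreRotation]
  have key := integrable_prod_of_section (μ := uniformAngle) hf
    (fun _ => log_one_div_dist_ge _ _) h1 (integrable_const _) h2
  refine ⟨hmp.integrable_comp_of_integrable key.1, ?_⟩
  have := integral_map (μ := Measure.pi fun _ : Fin n => uniformAngle) hmp.measurable.aemeasurable
    (by rw [hmp.map_eq]; exact hf.aestronglyMeasurable)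
  rw [← this, hmp.map_eq, key.2]
  simp

instance isProbabilityMeasure_fibredSphericalLaw (r : ℕ) :
    IsProbabilityMeasure (fibredSphericalLaw r) := by
  unfold fibredSphericalLaw
  infer_instance

theorem log_dist_fibres {r : ℕ} {i j : Fin r} (hij : i ≠ j) (a b : ℝ) :
    Integrable (fun ω : (Fin r → Sphere2) × (Fin r → ℝ) =>
      Real.log (1 / dist (fibreRotation (ω.2 i + a) (fibreBasePoint (ω.1 i)))
        (fibreRotation (ω.2 j + b) (fibreBasePoint (ω.1 j))))) (fibredSphericalLaw r) ∧
    ∫ ω, Real.log (1 / dist (fibreRotation (ω.2 i + a) (fibreBasePoint (ω.1 i)))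
        (fibreRotation (ω.2 j + b) (fibreBasePoint (ω.1 j)))) ∂fibredSphericalLaw r =
      ∫ y, -(1 / 2) * Real.log (1 + dist (y i) (y j) / 2) ∂sphericalEnsemble r := by
  have hrot := measurable_fibreRotation
  have hbase := measurable_fibreBasePoint
  have h1 : ∀ (l : Fin r) (c : ℝ), Measurable fun ω : (Fin r → Sphere2) × (Fin r → ℝ) =>
      fibreRotation (ω.2 l + c) (fibreBasePoint (ω.1 l)) := fun l c =>
    hrot.comp (f := fun ω : (Fin r → Sphere2) × (Fin r → ℝ) =>
      (ω.2 l + c, fibreBasePoint (ω.1 l))) (by fun_prop)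
  have h2 : Integrable (fun y : Fin r → Sphere2 => -(1 / 2) * Real.log (1 + dist (y i) (y j) / 2))
      (sphericalEnsemble r) := by
    refine Integrable.of_bound (C := 1) (Measurable.aestronglyMeasurable (by fun_prop))
      (ae_of_all _ fun y => ?_)
    have h1 : 0 ≤ dist (y i) (y j) := dist_nonneg
    have h2 := dist_sphere2_le_two (y i) (y j)
    have h3 := Real.log_nonneg (x := 1 + dist (y i) (y j) / 2) (by linarith)
    have h4 := Real.log_le_sub_one_of_pos (x := 1 + dist (y i) (y j) / 2) (by linarith)
    rw [Real.norm_eq_abs, abs_le]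
    constructor <;> linarith
  have h3 : Measurable fun ω : (Fin r → Sphere2) × (Fin r → ℝ) =>
      Real.log (1 / dist (fibreRotation (ω.2 i + a) (fibreBasePoint (ω.1 i)))
        (fibreRotation (ω.2 j + b) (fibreBasePoint (ω.1 j)))) :=
    (((h1 i a).dist (h1 j b)).const_div 1).log
  have h4 : ∀ y : Fin r → Sphere2, ∫ θ : Fin r → ℝ,
      Real.log (1 / dist (fibreRotation (θ i + a) (fibreBasePoint (y i)))
        (fibreRotation (θ j + b) (fibreBasePoint (y j)))) ∂(Measure.pi fun _ => uniformAngle) =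
      -(1 / 2) * Real.log (1 + dist (y i) (y j) / 2) := by
    intro y
    rw [(log_dist_fibres_uniformAngle hij a b _ _).2, hopfMap_fibreBasePoint, hopfMap_fibreBasePoint]
  exact integrable_prod_of_section h3 (fun _ => log_one_div_dist_ge _ _)
    (fun y => (log_dist_fibres_uniformAngle hij a b (fibreBasePoint (y i)) (fibreBasePoint (y j))).1)
    h2 h4

/-! ### Exact expected energy -/

theorem sum_log_dist_rootsOfUnity (k : ℕ) (m : Fin k) :
    ∑ n : Fin k, Real.log (1 / ‖Complex.exp ((2 * Real.pi * (m : ℕ) / k : ℝ) * Complex.I) -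
      Complex.exp ((2 * Real.pi * (n : ℕ) / k : ℝ) * Complex.I)‖) = -Real.log k := by
  obtain _ | K := k
  · exact m.elim0
  set ζ : ℂ := Complex.exp (2 * Real.pi * Complex.I / (K + 1 : ℕ)) with hζ
  have hprim : IsPrimitiveRoot ζ (K + 1) := Complex.isPrimitiveRoot_exp (K + 1) (by omega)
  have hexp : ∀ n : ℕ, Complex.exp ((2 * Real.pi * n / (K + 1 : ℕ) : ℝ) * Complex.I) = ζ ^ n := by
    intro n
    rw [hζ, ← Complex.exp_nat_mul]
    congr 1
    push_cast
    ring
  simp only [hexp]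
  have hζ1 : ‖ζ‖ = 1 := hprim.norm'_eq_one (by omega)
  have hmod : ∀ n : ℕ, ζ ^ (n % (K + 1)) = ζ ^ n := fun n =>
    (congrArg (fun l => ζ ^ (n % l)) hprim.eq_orderOf).trans (pow_mod_orderOf ζ n)
  have h1 : ∀ d : Fin (K + 1), ‖ζ ^ (m : ℕ) - ζ ^ ((m + d : Fin (K + 1)) : ℕ)‖ =
      ‖1 - ζ ^ (d : ℕ)‖ := by
    intro d
    have : ζ ^ ((m + d : Fin (K + 1)) : ℕ) = ζ ^ (m : ℕ) * ζ ^ (d : ℕ) := by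
      rw [Fin.val_add, ← pow_add, hmod]
    rw [this, ← mul_one_sub, norm_mul, norm_pow, hζ1, one_pow, one_mul]
  rw [← Equiv.sum_comp (Equiv.addLeft m)]
  simp only [Equiv.coe_addLeft, h1]
  -- After the shift `n = m + d`, the term `d = 0` is `log (1 / 0) = 0`; the others multiply to `∏
  -- (1 - ζ ^ d) = K + 1`.
  rw [Fin.sum_univ_succ]
  have hne : ∀ d : Fin K, 1 - ζ ^ ((d : ℕ) + 1) ≠ 0 := fun d h =>
    hprim.pow_ne_one_of_pos_of_lt (by omega) (by omega) (sub_eq_zero.1 h).symm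
  have h2 : ∑ d : Fin K, Real.log ‖1 - ζ ^ ((d : ℕ) + 1)‖ = Real.log (K + 1) := by
    rw [← Real.log_prod fun d _ => norm_ne_zero_iff.2 (hne d), ← norm_prod,
      Fin.prod_univ_eq_prod_range (fun d => 1 - ζ ^ (d + 1)), hprim.prod_one_sub_pow_eq_order]
    congr 1
    exact_mod_cast Complex.norm_natCast (K + 1)
  simp [Real.log_inv, h2]

theorem sum_log_dist_fibre (k : ℕ) (θ : ℝ) (q : Sphere3) :
    ∑ m : Fin k, ∑ n : Fin k, Real.log (1 / dist
      (fibreRotation (θ + 2 * Real.pi * (m : ℕ) / k) q)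
      (fibreRotation (θ + 2 * Real.pi * (n : ℕ) / k) q)) = -(k * Real.log k) := by
  have h : ∀ m n : ℕ, dist (fibreRotation (θ + 2 * Real.pi * m / k) q)
      (fibreRotation (θ + 2 * Real.pi * n / k) q) =
      ‖Complex.exp ((2 * Real.pi * m / k : ℝ) * Complex.I) -
        Complex.exp ((2 * Real.pi * n / k : ℝ) * Complex.I)‖ := by
    intro m n
    rw [dist_fibreRotation_fibreRotation, Complex.ofReal_add, Complex.ofReal_add, add_mul, add_mul,
      Complex.exp_add, Complex.exp_add, ← mul_sub, norm_mul, Complex.norm_exp_ofReal_mul_I, one_mul]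
  simp only [h, sum_log_dist_rootsOfUnity]
  simp

/-- The interaction of the fibres over `y i` and `y j`. -/
noncomputable def fibreInteraction (k r : ℕ) (i j : Fin r)
    (ω : (Fin r → Sphere2) × (Fin r → ℝ)) : ℝ :=
  ∑ m : Fin k, ∑ n : Fin k, Real.log (1 / dist
    (fibreRotation (ω.2 i + 2 * Real.pi * (m : ℕ) / k) (fibreBasePoint (ω.1 i)))
    (fibreRotation (ω.2 j + 2 * Real.pi * (n : ℕ) / k) (fibreBasePoint (ω.1 j))))

theorem fibredSphericalEnergy_eq (k r : ℕ) (ω : (Fin r → Sphere2) × (Fin r → ℝ)) :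
    fibredSphericalEnergy k r ω =
      ∑ i, ∑ j ∈ Finset.univ.erase i, fibreInteraction k r i j ω - r * (k * Real.log k) := by
  have h1 : fibredSphericalEnergy k r ω = ∑ i, ∑ j, fibreInteraction k r i j ω := by
    rw [fibredSphericalEnergy, logEnergy]
    -- The diagonal terms are `log (1 / 0) = 0`, so they may be restored and the sum arranged by
    -- fibres.
    have h2 : ∀ p : Fin r × Fin k, ∑ q ∈ Finset.univ.erase p,
        Real.log (1 / dist (fibredPoints k r ω.1 ω.2 p) (fibredPoints k r ω.1 ω.2 q)) =
        ∑ q, Real.log (1 / dist (fibredPoints k r ω.1 ω.2 p) (fibredPoints k r ω.1 ω.2 q)) :=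
      fun p => Finset.sum_erase _ (by simp)
    simp only [h2, Fintype.sum_prod_type]
    refine Finset.sum_congr rfl fun i _ => ?_
    rw [Finset.sum_comm]
    rfl
  have h3 : ∀ i, ∑ j, fibreInteraction k r i j ω =
      ∑ j ∈ Finset.univ.erase i, fibreInteraction k r i j ω - k * Real.log k := by
    intro i
    rw [← Finset.sum_erase_add _ _ (Finset.mem_univ i), fibreInteraction, sum_log_dist_fibre]
    ring
  rw [h1]
  simp only [h3]
  simp

theorem fibreInteraction_integrable {k r : ℕ} {i j : Fin r} (hij : i ≠ j) :
    Integrable (fibreInteraction k r i j) (fibredSphericalLaw r) :=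
  integrable_finsetSum _ fun _ _ => integrable_finsetSum _ fun _ _ => (log_dist_fibres hij _ _).1

theorem integral_fibreInteraction {k r : ℕ} {i j : Fin r} (hij : i ≠ j) :
    ∫ ω, fibreInteraction k r i j ω ∂fibredSphericalLaw r =
      k ^ 2 * ∫ y, -(1 / 2) * Real.log (1 + dist (y i) (y j) / 2) ∂sphericalEnsemble r := by
  simp only [fibreInteraction]
  rw [integral_finsetSum _ fun _ _ => integrable_finsetSum _ fun _ _ => (log_dist_fibres hij _ _).1]
  have h : ∀ m : Fin k, ∫ ω, ∑ n : Fin k, Real.log (1 / dist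
      (fibreRotation (ω.2 i + 2 * Real.pi * (m : ℕ) / k) (fibreBasePoint (ω.1 i)))
      (fibreRotation (ω.2 j + 2 * Real.pi * (n : ℕ) / k) (fibreBasePoint (ω.1 j))))
      ∂fibredSphericalLaw r =
      k * ∫ y, -(1 / 2) * Real.log (1 + dist (y i) (y j) / 2) ∂sphericalEnsemble r := by
    intro m
    rw [integral_finsetSum _ fun _ _ => (log_dist_fibres hij _ _).1]
    simp only [(log_dist_fibres hij _ _).2]
    simp
  simp only [h]
  simp
  ring

theorem integrable_fibredSphericalEnergy (k r : ℕ) :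
    Integrable (fibredSphericalEnergy k r) (fibredSphericalLaw r) := by
  have h : fibredSphericalEnergy k r = fun ω =>
      ∑ i, ∑ j ∈ Finset.univ.erase i, fibreInteraction k r i j ω - r * (k * Real.log k) :=
    funext (fibredSphericalEnergy_eq k r)
  rw [h]
  exact (integrable_finsetSum _ fun i _ => integrable_finsetSum _ fun j hj =>
    fibreInteraction_integrable (Finset.ne_of_mem_erase hj).symm).sub (integrable_const _)

theorem integral_fibredSphericalEnergy (k r : ℕ) :
    ∫ ω, fibredSphericalEnergy k r ω ∂fibredSphericalLaw r =
      k ^ 2 * (r ^ 2 * ∫ t in Set.Ioo (0 : ℝ) 1,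
        -(1 / 2) * Real.log (1 + Real.sqrt t) * (1 - (1 - t) ^ (r - 1))) -
      r * (k * Real.log k) := by
  simp only [fibredSphericalEnergy_eq]
  have hint : ∀ i : Fin r, ∀ j ∈ Finset.univ.erase i,
      Integrable (fibreInteraction k r i j) (fibredSphericalLaw r) :=
    fun i j hj => fibreInteraction_integrable (Finset.ne_of_mem_erase hj).symm
  rw [integral_sub (integrable_finsetSum _ fun i _ => integrable_finsetSum _ fun j hj =>
    hint i j hj) (integrable_const _),
    integral_finsetSum _ fun i _ => integrable_finsetSum _ fun j hj => hint i j hj]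
  have h1 : ∀ i : Fin r, ∫ ω, ∑ j ∈ Finset.univ.erase i, fibreInteraction k r i j ω
      ∂fibredSphericalLaw r = k ^ 2 * ∑ j ∈ Finset.univ.erase i,
        ∫ y, -(1 / 2) * Real.log (1 + Real.sqrt (dist (y i) (y j) ^ 2 / 4)) ∂sphericalEnsemble r := by
    intro i
    rw [integral_finsetSum _ fun j hj => hint i j hj, Finset.mul_sum]
    refine Finset.sum_congr rfl fun j hj => ?_
    rw [integral_fibreInteraction (Finset.ne_of_mem_erase hj).symm]
    have h2 : ∀ y : Fin r → Sphere2, Real.sqrt (dist (y i) (y j) ^ 2 / 4) = dist (y i) (y j) / 2 := by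
      intro y
      rw [show dist (y i) (y j) ^ 2 / 4 = (dist (y i) (y j) / 2) ^ 2 by ring,
        Real.sqrt_sq (by positivity)]
    simp only [h2]
  simp only [h1]
  rw [← Finset.mul_sum, sum_integral_sphericalEnsemble r
    (G := fun t => -(1 / 2) * Real.log (1 + Real.sqrt t)) (by fun_prop)]
  · simp
  · refine ⟨1, fun t ht => ?_⟩
    have h1 := Real.sqrt_nonneg t
    have h2 : Real.sqrt t ≤ 1 := Real.sqrt_le_one.2 ht.2
    have h3 := Real.log_nonneg (x := 1 + Real.sqrt t) (by linarith)
    have h4 := Real.log_le_sub_one_of_pos (x := 1 + Real.sqrt t) (by linarith)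
    rw [abs_le]
    constructor <;> linarith

/-! ### Asymptotics of the correction integral -/

theorem integral_sqrt_mul_one_sub_pow (n : ℕ) :
    ∫ t in Set.Ioo (0 : ℝ) 1, Real.sqrt t * (1 - t) ^ n =
      n.factorial / ∏ j ∈ Finset.range (n + 1), ((3 / 2 : ℝ) + j) := by
  have h := Complex.betaIntegral_eval_nat_add_one_right (u := (3 / 2 : ℝ)) (by norm_num) n
  rw [← Complex.ofReal_inj, ← integral_complex_ofReal,
    Measure.restrict_congr_set Ioo_ae_eq_Ioc]
  push_cast at h ⊢
  rw [← h, Complex.betaIntegral, intervalIntegral.integral_of_le zero_le_one]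
  refine setIntegral_congr_fun measurableSet_Ioc fun t ht => ?_
  simp only [add_sub_cancel_right, Complex.cpow_natCast]
  rw [Real.sqrt_eq_rpow, Complex.ofReal_cpow ht.1.le]
  norm_num

theorem integral_id_mul_one_sub_pow (n : ℕ) :
    ∫ t in Set.Ioo (0 : ℝ) 1, t * (1 - t) ^ n = 1 / ((n + 1) * (n + 2)) := by
  have h := integral_pow_mul_one_sub_pow 1 n
  rw [← Complex.ofReal_inj, ← integral_complex_ofReal]
  have h1 : ∀ t : ℝ, ((t * (1 - t) ^ n : ℝ) : ℂ) = (t : ℂ) ^ 1 * ((1 - t : ℝ) : ℂ) ^ n := by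
    intro t
    push_cast
    ring
  simp only [h1]
  rw [h, Nat.factorial_one, show 1 + n + 1 = (n + 1) + 1 by ring, Nat.factorial_succ, Nat.factorial_succ]
  have h0 : (n.factorial : ℂ) ≠ 0 := by exact_mod_cast Nat.factorial_ne_zero n
  have h2 : (n + 1 : ℂ) ≠ 0 := by exact_mod_cast Nat.succ_ne_zero n
  have h3 : (n + 2 : ℂ) ≠ 0 := by exact_mod_cast Nat.succ_ne_zero (n + 1)
  have h4 : (n + 1 + 1 : ℂ) ≠ 0 := by exact_mod_cast Nat.succ_ne_zero (n + 1)
  push_cast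
  field_simp
  ring

theorem integral_log_one_add_sqrt :
    ∫ t in Set.Ioo (0 : ℝ) 1, Real.log (1 + Real.sqrt t) = 1 / 2 := by
  rw [Measure.restrict_congr_set Ioo_ae_eq_Ioc, ← intervalIntegral.integral_of_le zero_le_one]
  have hpos : ∀ t : ℝ, 1 + Real.sqrt t ≠ 0 := fun t => by positivity
  have hcl : Continuous fun t : ℝ => Real.log (1 + Real.sqrt t) :=
    (continuous_const.add Real.continuous_sqrt).log hpos
  -- The factor `t - 1 = (√t - 1)(√t + 1)` cancels the denominator in the derivative of the
  -- logarithm, and the terms `√t - t / 2` remove what is left.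
  rw [intervalIntegral.integral_eq_sub_of_hasDerivAt_of_le zero_le_one
    (f := fun t => (t - 1) * Real.log (1 + Real.sqrt t) + Real.sqrt t - t / 2)]
  · norm_num
  · fun_prop
  · intro t ht
    have hs : Real.sqrt t ≠ 0 := (Real.sqrt_pos.2 ht.1).ne'
    have h1 := Real.hasDerivAt_sqrt ht.1.ne'
    have h2 := (h1.const_add 1).log (hpos t)
    have h3 := ((((hasDerivAt_id t).sub_const 1).mul h2).add h1).sub ((hasDerivAt_id t).div_const 2)
    convert! h3 using 1
    have h4 : t = Real.sqrt t * Real.sqrt t := (Real.mul_self_sqrt ht.1.le).symm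
    have h5 := hpos t
    simp only [id]
    field_simp
    linear_combination (-1 : ℝ) * h4
  · exact hcl.intervalIntegrable _ _

theorem integrableOn_Ioo_of_continuous {f : ℝ → ℝ} (hf : Continuous f) :
    Integrable f (volume.restrict (Set.Ioo 0 1)) :=
  (hf.continuousOn.integrableOn_Icc (a := 0) (b := 1)).mono_set Set.Ioo_subset_Icc_self

theorem continuous_log_one_add_sqrt : Continuous fun t : ℝ => Real.log (1 + Real.sqrt t) :=
  (continuous_const.add Real.continuous_sqrt).log fun t =>
    (show 0 < 1 + Real.sqrt t by positivity).ne'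

/-- The correction integral in the expected energy. -/
noncomputable def correction (n : ℕ) : ℝ :=
  ∫ t in Set.Ioo (0 : ℝ) 1, Real.log (1 + Real.sqrt t) * (1 - t) ^ n

theorem integral_fibredSphericalEnergy_eq (k r : ℕ) :
    ∫ ω, fibredSphericalEnergy k r ω ∂fibredSphericalLaw r =
      -((k * r : ℝ) ^ 2 / 4) + (k * r : ℝ) ^ 2 / 2 * correction (r - 1) - r * (k * Real.log k) := by
  rw [integral_fibredSphericalEnergy]
  have hc := continuous_log_one_add_sqrt
  have h : ∫ t in Set.Ioo (0 : ℝ) 1, -(1 / 2) * Real.log (1 + Real.sqrt t) *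
      (1 - (1 - t) ^ (r - 1)) = -(1 / 4) + 1 / 2 * correction (r - 1) := by
    have h1 : ∀ t : ℝ, -(1 / 2) * Real.log (1 + Real.sqrt t) * (1 - (1 - t) ^ (r - 1)) =
        -(1 / 2) * Real.log (1 + Real.sqrt t) +
          1 / 2 * (Real.log (1 + Real.sqrt t) * (1 - t) ^ (r - 1)) := fun t => by ring
    simp only [h1]
    rw [integral_add (integrableOn_Ioo_of_continuous (by fun_prop))
      (integrableOn_Ioo_of_continuous (by fun_prop)), integral_const_mul, integral_const_mul,
      integral_log_one_add_sqrt, correction]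
    ring
  rw [h]
  ring

/-- Integrate `√t - t/2 ≤ log (1 + √t) ≤ √t` against `(1 - t) ^ n`; both sides are beta integrals.
-/
theorem correction_bounds (n : ℕ) :
    n.factorial / ∏ j ∈ Finset.range (n + 1), ((3 / 2 : ℝ) + j) - 1 / 2 * (1 / ((n + 1) * (n + 2))) ≤
      correction n ∧
    correction n ≤ n.factorial / ∏ j ∈ Finset.range (n + 1), ((3 / 2 : ℝ) + j) := by
  have hc := continuous_log_one_add_sqrt
  have hs := Real.continuous_sqrt
  rw [← integral_sqrt_mul_one_sub_pow, ← integral_id_mul_one_sub_pow, ← integral_const_mul,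
    ← integral_sub (integrableOn_Ioo_of_continuous (by fun_prop))
      (integrableOn_Ioo_of_continuous (by fun_prop))]
  constructor
  · refine setIntegral_mono_on (integrableOn_Ioo_of_continuous (by fun_prop))
      (integrableOn_Ioo_of_continuous (by fun_prop)) measurableSet_Ioo fun t ht => ?_
    have h0 : 0 ≤ (1 - t) ^ n := pow_nonneg (by linarith [ht.2]) n
    have h1 := Real.sqrt_nonneg t
    have h2 := Real.le_log_one_add_of_nonneg h1
    -- The quadratic lower bound is deduced from `2 x / (x + 2) ≤ log (1 + x)` at `x = √t`.
    have h3 : Real.sqrt t - Real.sqrt t ^ 2 / 2 ≤ 2 * Real.sqrt t / (Real.sqrt t + 2) := by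
      rw [le_div_iff₀ (by linarith)]
      nlinarith [pow_nonneg h1 3]
    rw [Real.sq_sqrt ht.1.le] at h3
    have := mul_le_mul_of_nonneg_right (h3.trans h2) h0
    linarith
  · refine setIntegral_mono_on (integrableOn_Ioo_of_continuous (by fun_prop))
      (integrableOn_Ioo_of_continuous (by fun_prop)) measurableSet_Ioo fun t ht => ?_
    have h1 := Real.sqrt_nonneg t
    have h2 := Real.log_le_sub_one_of_pos (x := 1 + Real.sqrt t) (by linarith)
    exact mul_le_mul_of_nonneg_right (by linarith) (pow_nonneg (by linarith [ht.2]) n)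

theorem tendsto_rpow_mul_correction :
    Tendsto (fun n : ℕ => (n : ℝ) ^ (3 / 2 : ℝ) * correction n) atTop (𝓝 (Real.sqrt Real.pi / 2)) := by
  have hG : Tendsto (fun n : ℕ => (n : ℝ) ^ (3 / 2 : ℝ) *
      (n.factorial / ∏ j ∈ Finset.range (n + 1), ((3 / 2 : ℝ) + j))) atTop
      (𝓝 (Real.sqrt Real.pi / 2)) := by
    -- The scaled main term is Euler's sequence for `Γ(3/2) = √π / 2`.
    have h := Real.GammaSeq_tendsto_Gamma (3 / 2)
    rw [show (3 / 2 : ℝ) = 1 / 2 + 1 by norm_num, Real.Gamma_add_one (by norm_num),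
      Real.Gamma_one_half_eq, one_div_mul_eq_div] at h
    refine h.congr fun n => ?_
    rw [Real.GammaSeq, mul_div_assoc]
    norm_num
  have hE : Tendsto (fun n : ℕ => (n : ℝ) ^ (3 / 2 : ℝ) * (1 / 2 * (1 / ((n + 1) * (n + 2)))))
      atTop (𝓝 0) := by
    have h := (tendsto_rpow_neg_atTop (y := 1 / 2) (by norm_num)).comp
      (tendsto_natCast_atTop_atTop (R := ℝ))
    refine squeeze_zero' (Eventually.of_forall fun n => by positivity) ?_ h
    filter_upwards [eventually_gt_atTop 0] with n hn
    have hn' : (0 : ℝ) < n := by exact_mod_cast hn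
    rw [Function.comp, show (-(1 / 2) : ℝ) = 3 / 2 - (2 : ℕ) by norm_num,
      Real.rpow_sub_natCast hn'.ne', div_eq_mul_one_div]
    refine mul_le_mul_of_nonneg_left ?_ (by positivity)
    have : 1 / ((n + 1) * (n + 2) : ℝ) ≤ 1 / (n : ℝ) ^ 2 :=
      one_div_le_one_div_of_le (by positivity) (by nlinarith)
    have : 0 ≤ 1 / ((n + 1) * (n + 2) : ℝ) := by positivity
    rw [← one_div]
    linarith
  have hL := hG.sub hE
  rw [sub_zero] at hL
  refine tendsto_of_tendsto_of_tendsto_of_le_of_le hL hG (fun n => ?_) fun n => ?_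
  · simp only
    rw [← mul_sub]
    exact mul_le_mul_of_nonneg_left (correction_bounds n).1 (by positivity)
  · exact mul_le_mul_of_nonneg_left (correction_bounds n).2 (by positivity)

theorem tendsto_rpow_mul_correction_sub_one :
    Tendsto (fun r : ℕ => (r : ℝ) ^ (3 / 2 : ℝ) * correction (r - 1)) atTop
      (𝓝 (Real.sqrt Real.pi / 2)) := by
  rw [← tendsto_add_atTop_iff_nat 1]
  have h1 : Tendsto (fun n : ℕ => (1 + 1 / (n : ℝ)) ^ (3 / 2 : ℝ)) atTop (𝓝 1) := by
    have := (tendsto_one_div_atTop_nhds_zero_nat (𝕜 := ℝ)).const_add 1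
    rw [add_zero] at this
    simpa using this.rpow_const (p := 3 / 2) (Or.inl one_ne_zero)
  have h2 := h1.mul tendsto_rpow_mul_correction
  rw [one_mul] at h2
  refine h2.congr' ?_
  filter_upwards [eventually_gt_atTop 0] with n hn
  have hn' : (0 : ℝ) < n := by exact_mod_cast hn
  rw [← mul_assoc, ← Real.mul_rpow (by positivity) hn'.le, Nat.add_sub_cancel]
  congr 2
  push_cast
  field_simp

/-! ### Uniform remainder and the linear coefficient -/

theorem energy_remainder {δ : ℝ} (hδ : 0 < δ) {ε : ℝ} (hε : 0 < ε) : ∃ k₀ : ℕ, ∀ k : ℕ, k₀ ≤ k →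
      ∀ A B r N : ℕ, 0 < A → 0 < B → δ ≤ (A : ℝ) / B →
        (r : ℝ) = (A : ℝ) / B * (k : ℝ) ^ 2 → N = k * r →
        |(∫ ω, fibredSphericalEnergy k r ω ∂(fibredSphericalLaw r)) -
            (-((N : ℝ) ^ 2 / 4) - 1 / 3 * N * Real.log N + N * linearCoefficient A B)|
          ≤ ε * N := by
  -- This tolerance turns the exact error factor `(1/2) k² √r` into `ε k √r (√δ k)`, at most `ε k r
  -- = ε N` because `√δ k ≤ √r`.
  have hη : 0 < 2 * ε * Real.sqrt δ := by positivity
  obtain ⟨R, hR⟩ := Metric.tendsto_atTop.1 tendsto_rpow_mul_correction_sub_one _ hη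
  -- For `k ≥ 1` and `k ≥ R / δ` one has `r ≥ δ k² ≥ δ k ≥ R`; the threshold depends on `A, B` only
  -- through `δ`.
  refine ⟨max 1 ⌈R / δ⌉₊, fun k hk A B r N hA hB hAB hr hN => ?_⟩
  subst hN
  have hk1 : 1 ≤ k := (le_max_left _ _).trans hk
  have hkR : R / δ ≤ k := (Nat.le_ceil _).trans (by exact_mod_cast (le_max_right _ _).trans hk)
  have hA' : (0 : ℝ) < A := by exact_mod_cast hA
  have hB' : (0 : ℝ) < B := by exact_mod_cast hB
  have hk' : (1 : ℝ) ≤ k := by exact_mod_cast hk1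
  have hk0 : (0 : ℝ) < k := by linarith
  have hr0 : (0 : ℝ) < r := by rw [hr]; positivity
  have hδr : δ * (k : ℝ) ^ 2 ≤ r := by
    rw [hr]
    exact mul_le_mul_of_nonneg_right hAB (by positivity)
  have hrR : R ≤ r := by
    have h1 : (R : ℝ) ≤ k * δ := (div_le_iff₀ hδ).1 hkR
    have h2 : (k : ℝ) * δ ≤ δ * (k : ℝ) ^ 2 := by nlinarith [mul_pos hδ hk0]
    exact_mod_cast h1.trans (h2.trans hδr)
  have ha := (hR r hrR).le
  rw [Real.dist_eq] at ha
  have hq : (B : ℝ) / A = (k : ℝ) ^ 2 / r := by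
    rw [hr]
    field_simp
  set s := Real.sqrt r with hs
  have hs0 : 0 < s := Real.sqrt_pos.2 hr0
  have hs2 : (r : ℝ) = s ^ 2 := (Real.sq_sqrt hr0.le).symm
  have hr32 : (r : ℝ) ^ (3 / 2 : ℝ) = s ^ 3 := by
    rw [hs, Real.sqrt_eq_rpow, ← Real.rpow_natCast, ← Real.rpow_mul hr0.le]
    norm_num
  have hroot : ((k : ℝ) ^ 2 / r) ^ (1 / 2 : ℝ) = k / s := by
    rw [← Real.sqrt_eq_rpow, Real.sqrt_div (by positivity), Real.sqrt_sq hk0.le]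
  have hlog : Real.log (((k : ℝ) ^ 2 / r) ^ (1 / 3 : ℝ)) = 1 / 3 * (2 * Real.log k - Real.log r) := by
    rw [Real.log_rpow (by positivity), Real.log_div (by positivity) hr0.ne', Real.log_pow]
    push_cast
    rfl
  have hδs : Real.sqrt δ * k ≤ s := by
    rw [hs]
    refine Real.le_sqrt_of_sq_le ?_
    rw [mul_pow, Real.sq_sqrt hδ.le]
    exact hδr
  -- Since `B/A = k²/r`, the logarithmic terms cancel identically and only the correction integral
  -- minus its limit survives.
  have hdiff : (∫ ω, fibredSphericalEnergy k r ω ∂(fibredSphericalLaw r)) -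
      (-(((k * r : ℕ) : ℝ) ^ 2 / 4) - 1 / 3 * ((k * r : ℕ) : ℝ) * Real.log ((k * r : ℕ) : ℝ) +
        ((k * r : ℕ) : ℝ) * linearCoefficient A B) =
      1 / 2 * k ^ 2 * s * ((r : ℝ) ^ (3 / 2 : ℝ) * correction (r - 1) - Real.sqrt Real.pi / 2) := by
    rw [integral_fibredSphericalEnergy_eq, linearCoefficient, hq, hroot, hlog, hr32]
    push_cast
    rw [Real.log_mul hk0.ne' hr0.ne']
    generalize Real.log r = l
    rw [hs2]
    field_simp
    ring
  rw [hdiff, abs_mul, abs_of_nonneg (by positivity)]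
  calc 1 / 2 * (k : ℝ) ^ 2 * s * |(r : ℝ) ^ (3 / 2 : ℝ) * correction (r - 1) - Real.sqrt Real.pi / 2|
      ≤ 1 / 2 * (k : ℝ) ^ 2 * s * (2 * ε * Real.sqrt δ) := by gcongr
    _ = ε * k * s * (Real.sqrt δ * k) := by ring
    _ ≤ ε * k * s * s := by gcongr
    _ = ε * ((k * r : ℕ) : ℝ) := by push_cast; rw [hs2]; ring

/-- As a function of `x = A/B` the coefficient is continuous at `9π/64`, where its derivative
vanishes; there the square-root term equals `2/3`. -/
theorem tendsto_linearCoefficient :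
    Tendsto (fun p : ℕ × ℕ => linearCoefficient p.1 p.2)
      (comap (fun p : ℕ × ℕ => (p.1 : ℝ) / p.2) (𝓝 (9 * Real.pi / 64)))
      (𝓝 (1 / 3 * (2 + Real.log (9 * Real.pi / 64)))) := by
  have hpi := Real.pi_pos
  have hx : (0 : ℝ) < 9 * Real.pi / 64 := by positivity
  have h1 : ContinuousAt (fun x : ℝ => Real.sqrt Real.pi / 4 * (x⁻¹) ^ (1 / 2 : ℝ) -
      Real.log ((x⁻¹) ^ (1 / 3 : ℝ))) (9 * Real.pi / 64) := by
    have hinv : ContinuousAt (fun x : ℝ => x⁻¹) (9 * Real.pi / 64) := continuousAt_inv₀ hx.ne'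
    have hne : (9 * Real.pi / 64)⁻¹ ≠ 0 := (inv_pos.2 hx).ne'
    exact (continuousAt_const.mul (hinv.rpow_const (Or.inl hne))).sub
      ((hinv.rpow_const (Or.inl hne)).log (Real.rpow_pos_of_pos (inv_pos.2 hx) _).ne')
  have h2 : Real.sqrt Real.pi / 4 * ((9 * Real.pi / 64)⁻¹) ^ (1 / 2 : ℝ) -
      Real.log (((9 * Real.pi / 64)⁻¹) ^ (1 / 3 : ℝ)) = 1 / 3 * (2 + Real.log (9 * Real.pi / 64)) := by
    have h3 : ((9 * Real.pi / 64)⁻¹) ^ (1 / 2 : ℝ) = 8 / (3 * Real.sqrt Real.pi) := by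
      rw [← Real.sqrt_eq_rpow, Real.sqrt_eq_iff_mul_self_eq (by positivity) (by positivity)]
      have := Real.mul_self_sqrt hpi.le
      field_simp
      rw [Real.sq_sqrt hpi.le]
      ring
    rw [h3, Real.log_rpow (inv_pos.2 hx), Real.log_inv]
    field_simp
    ring
  have h4 := h1.tendsto
  rw [h2] at h4
  refine (h4.comp tendsto_comap).congr fun p => ?_
  simp only [Function.comp, linearCoefficient, inv_div]

theorem linearCoefficient_limit_bounds :
    0.394 ≤ 1 / 3 * (2 + Real.log (9 * Real.pi / 64)) ∧
      1 / 3 * (2 + Real.log (9 * Real.pi / 64)) < 0.395 := by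
  have hp1 := Real.pi_gt_d4
  have hp2 := Real.pi_lt_d4
  have hx : (0 : ℝ) < 9 * Real.pi / 64 := by positivity
  -- The thresholds solve `(2 + l) / 3 = 0.394` and `(2 + l) / 3 = 0.395`, namely `l = -0.818` and
  -- `l = -0.815`; each follows from a Taylor bound for `exp` and four decimals of `π`.
  have h1 : (-(409 / 500) : ℝ) ≤ Real.log (9 * Real.pi / 64) := by
    rw [Real.le_log_iff_exp_le hx, Real.exp_neg]
    have h := Real.sum_le_exp_of_nonneg (x := (409 / 500)) (by norm_num) 7
    norm_num [Finset.sum_range_succ, Nat.factorial] at h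
    refine inv_le_of_inv_le₀ hx (le_trans ?_ h)
    rw [inv_le_comm₀ hx (by norm_num)]
    norm_num
    linarith
  have h2 : Real.log (9 * Real.pi / 64) < -(163 / 200) := by
    rw [Real.log_lt_iff_lt_exp hx, Real.exp_neg]
    have h := Real.exp_bound' (x := 163 / 200) (by norm_num) (by norm_num) (n := 6) (by norm_num)
    norm_num [Finset.sum_range_succ, Nat.factorial] at h
    rw [lt_inv_comm₀ hx (Real.exp_pos _)]
    refine lt_of_le_of_lt h ?_
    rw [lt_inv_comm₀ (by norm_num) hx]
    norm_num
    linarith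
  constructor <;> linarith

theorem theorem1p2 :
    (∀ k r : ℕ, IsProbabilityMeasure (fibredSphericalLaw r) ∧
      Integrable (fibredSphericalEnergy k r) (fibredSphericalLaw r)) ∧
    (∀ δ : ℝ, 0 < δ → ∀ ε : ℝ, 0 < ε → ∃ k₀ : ℕ, ∀ k : ℕ, k₀ ≤ k →
      ∀ A B r N : ℕ, 0 < A → 0 < B → δ ≤ (A : ℝ) / B →
        (r : ℝ) = (A : ℝ) / B * (k : ℝ) ^ 2 → N = k * r →
        |(∫ ω, fibredSphericalEnergy k r ω ∂(fibredSphericalLaw r)) -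
            (-((N : ℝ) ^ 2 / 4) - 1 / 3 * N * Real.log N + N * linearCoefficient A B)|
          ≤ ε * N) ∧
    Tendsto (fun p : ℕ × ℕ => linearCoefficient p.1 p.2)
      (comap (fun p : ℕ × ℕ => (p.1 : ℝ) / p.2) (𝓝 (9 * Real.pi / 64)))
      (𝓝 (1 / 3 * (2 + Real.log (9 * Real.pi / 64)))) ∧
    (0.394 ≤ 1 / 3 * (2 + Real.log (9 * Real.pi / 64)) ∧
      1 / 3 * (2 + Real.log (9 * Real.pi / 64)) < 0.395) := by
  exact ⟨fun k r => ⟨inferInstance, integrable_fibredSphericalEnergy k r⟩,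
    fun δ hδ ε hε => energy_remainder hδ hε, tendsto_linearCoefficient,
    linearCoefficient_limit_bounds⟩
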